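/- Let $G$ be a finite simple graph that is $3$-connected (it has more than three vertices, and no set of fewer than three vertices disconnects it) and planar (its vertices and edges can be drawn in the plane as distinct points and simple arcs joining the endpoints, so that an arc contains no vertex other than the endpoints of its edge and two arcs meet only in common endpoints of their edges). Let $C$ be any cycle in $G$. The bridges of $C$ are: for every connected component $X$ of $G \setminus C$, the induced subgraph $G[X \cup A_X]$, where $A_X$ is the set of vertices of $C$ adjacent to some vertex of $X$ (its points of attachment); and every chord of $C$, whose points of attachment are its two endpoints. Two distinct bridges $B_1, B_2$ of $C$ conflict if either there are four distinct vertices $a_1, a_2, a_1', a_2'$ occurring in this order along $C$ such that $a_i, a_i'$ are points of attachment of $B_i$ for $i = 1, 2$, or $B_1$ and $B_2$ have three common points of attachment. The conflict graph $H_C(G)$ has the bridges of $C$ as its vertices, two of them being joined by an edge if and only if they conflict. Then $H_C(G)$ is bipartite and connected (in particular nonempty). -/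

import Mathlib

namespace SimpleGraph

variable {V : Type*}

/-- A graph is 3-connected if it has more than three vertices and no set of fewer than three
vertices disconnects it. -/
def IsThreeConnected (G : SimpleGraph V) : Prop :=
  3 < ENat.card V ∧
    ∀ S : Finset V, S.card < 3 → (G.induce {v | v ∉ S}).Connected

/-- A drawing of a graph in the Euclidean plane without crossings: vertices are distinct points,
every edge is a simple arc joining its two endpoints, an arc contains no vertices other than the
endpoints of its edge, and two arcs meet only in common endpoints of their edges. -/
structure PlaneDrawing (G : SimpleGraph V) where
  /-- the point that represents a vertex -/
  point : V → EuclideanSpace ℝ (Fin 2)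
  /-- the set of points of the arc that represents an edge -/
  arc : G.edgeSet → Set (EuclideanSpace ℝ (Fin 2))
  point_injective : Function.Injective point
  exists_path : ∀ (u v : V) (h : G.Adj u v), ∃ γ : _root_.Path (point u) (point v),
    Function.Injective γ ∧ Set.range γ = arc ⟨s(u, v), h⟩
  mem_of_point_mem : ∀ (w : V) (e : G.edgeSet), point w ∈ arc e → w ∈ (e : Sym2 V)
  arc_inter : ∀ e e' : G.edgeSet, e ≠ e' → ∀ x ∈ arc e ∩ arc e',
    ∃ w : V, w ∈ (e : Sym2 V) ∧ w ∈ (e' : Sym2 V) ∧ x = point w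

/-- A graph is planar if it can be drawn in the plane without crossings. -/
def IsPlanar (G : SimpleGraph V) : Prop := Nonempty (PlaneDrawing G)

namespace Walk

variable {G : SimpleGraph V} {v₀ : V}

/-- The vertex sets of the connected components of `G ∖ C`, as sets of vertices of `G`. -/
def IsOffComponent (C : G.Walk v₀ v₀) (X : Set V) : Prop :=
  ∃ K : (G.induce {w | w ∉ C.support}).ConnectedComponent, X = Subtype.val '' K.supp

/-- The vertices of `C` that are adjacent to some vertex of `X`. -/
def adjacentOn (C : G.Walk v₀ v₀) (X : Set V) : Set V :=
  {a | a ∈ C.support ∧ ∃ x ∈ X, G.Adj x a}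

/-- The bridges of a cycle `C`: for every connected component `X` of `G ∖ C` the subgraph of `G`
induced on `X` together with the vertices of `C` adjacent to `X`; and every chord of `C`,
as a subgraph consisting of one edge and its endpoints. -/
def IsCycleBridge (C : G.Walk v₀ v₀) (B : G.Subgraph) : Prop :=
  (∃ X : Set V, C.IsOffComponent X ∧
    B = (⊤ : G.Subgraph).induce (X ∪ C.adjacentOn X)) ∨
  (∃ (a b : V) (h : G.Adj a b), C.IsChord s(a, b) ∧ B = G.subgraphOfAdj h)

/-- The points of attachment of a bridge: its vertices on `C`. For the bridge of a component `X`
these are the vertices of `C` adjacent to `X`, for a chord they are its endpoints. -/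
def attachments (C : G.Walk v₀ v₀) (B : G.Subgraph) : Set V :=
  {a | a ∈ B.verts ∧ a ∈ C.support}

/-- The set `A` contains points `a`, `a'` and the set `A'` contains points `b`, `b'` such that
the four points are distinct and occur in the order `a, b, a', b'` along the cycle `C`.
The cyclic order is read off from the positions `0, …, C.length - 1` on the closed walk `C`;
the two alternatives are the two kinds of points at which the traversal may start. -/
def Interlace (C : G.Walk v₀ v₀) (A A' : Set V) : Prop :=
  ∃ i j k l : ℕ, i < j ∧ j < k ∧ k < l ∧ l < C.length ∧
    ((C.getVert i ∈ A ∧ C.getVert j ∈ A' ∧ C.getVert k ∈ A ∧ C.getVert l ∈ A') ∨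
     (C.getVert i ∈ A' ∧ C.getVert j ∈ A ∧ C.getVert k ∈ A' ∧ C.getVert l ∈ A))

/-- Two bridges conflict if their points of attachment interlace along `C`, or if they have three
common points of attachment. -/
def Conflict (C : G.Walk v₀ v₀) (B₁ B₂ : G.Subgraph) : Prop :=
  C.Interlace (C.attachments B₁) (C.attachments B₂) ∨
  ∃ x y z : V, x ≠ y ∧ y ≠ z ∧ x ≠ z ∧
    x ∈ C.attachments B₁ ∩ C.attachments B₂ ∧
    y ∈ C.attachments B₁ ∩ C.attachments B₂ ∧
    z ∈ C.attachments B₁ ∩ C.attachments B₂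

theorem Conflict.symm {C : G.Walk v₀ v₀} {B₁ B₂ : G.Subgraph} (h : C.Conflict B₁ B₂) :
    C.Conflict B₂ B₁ := by
  rcases h with ⟨i, j, k, l, hij, hjk, hkl, hl, h⟩ | ⟨x, y, z, hxy, hyz, hxz, hx, hy, hz⟩
  · exact Or.inl ⟨i, j, k, l, hij, hjk, hkl, hl, h.symm⟩
  · exact Or.inr ⟨x, y, z, hxy, hyz, hxz, hx.symm, hy.symm, hz.symm⟩

/-- The conflict graph of `G` with respect to a cycle `C`: the vertices are the bridges of `C`,
and two distinct bridges are adjacent if and only if they conflict. -/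
def conflictGraph (C : G.Walk v₀ v₀) : SimpleGraph {B : G.Subgraph // C.IsCycleBridge B} where
  Adj B₁ B₂ := B₁ ≠ B₂ ∧ C.Conflict B₁.1 B₂.1
  symm := ⟨fun _ _ h => ⟨h.1.symm, h.2.symm⟩⟩
  loopless := ⟨fun _ h => h.1 rfl⟩

end Walk

end SimpleGraph

/-! Bipartiteness uses planarity only. For a closed curve of the drawing, the parity of its winding
number tells on which side a point lies. These parities come from continuous logarithms. If two arcs
`γ` and `δ` are disjoint, then `γ s - δ t` has no zero on the unit square, hence has a continuous
logarithm there, and its increments around the boundary sum to zero. Read modulo 2, this relates the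
turns of each arc around the ends of the other. It is the only topological input, and no Jordan
curve theorem is needed. The three relations for opposite edges of a subdivided `K₄` add up to 1
(`walkTurn_tetrahedron`). For either kind of conflict, such a `K₄` built from `C` and paths inside
the two bridges shows that interior points of the bridges lie on different sides of `C`. The side is
therefore a proper 2-coloring of the conflict graph.

Connectedness uses 3-connectivity only. Let `K` be a component of the conflict graph and `D` a
bridge outside it. Two attachments of `D` cut `C` into two arcs, and all attachments of `K` lie in
one closed arc (`not_inner_and_outer_of_reachable`). If some vertex of `C` were not an attachment of
`K`, it would lie in a gap between two attachments of `K`. By 3-connectivity some bridge joins this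
gap to the rest of `C`, and it would separate the two ends of the gap, a contradiction. So `K` is
attached to all of `C` (`exists_reachable_attached`). Then a bridge outside `K` cannot have two
nonconsecutive attachments, which leaves only bridges attached to all three vertices of a triangle,
and these conflict pairwise. -/

section

/-! ### Continuous logarithms and parities of turns -/

open Set Complex unitInterval

/-- A nowhere vanishing continuous function on a square has a continuous logarithm. -/
theorem exists_continuous_exp_eq_square (f : I × I → ℂ) (hf : Continuous f) (h0 : ∀ x, f x ≠ 0) :
    ∃ F : I × I → ℂ, Continuous F ∧ ∀ x, exp (F x) = f x := by
  -- Retracting the plane onto the square moves the lifting problem to the simply connected space `ℝ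
  -- × ℝ`.
  let π : ℝ × ℝ → I × I :=
    fun x => (projIcc 0 1 zero_le_one x.1, projIcc 0 1 zero_le_one x.2)
  have hπ : Continuous π := by
    have := continuous_projIcc (a := (0 : ℝ)) (b := 1) (h := zero_le_one)
    fun_prop
  obtain ⟨F, ⟨-, hF⟩, -⟩ := isCoveringMapOn_exp.existsUnique_continuousMap_lifts
    ⟨fun x => f (π x), hf.comp hπ⟩ (a₀ := (0, 0)) (e₀ := log (f (π (0, 0))))
    (exp_log (h0 _)) (fun x => h0 _)
  refine ⟨fun x => F (x.1, x.2), by fun_prop, fun x => ?_⟩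
  have := congrFun hF (x.1, x.2)
  simpa [π] using this

/-- The increment of a continuous logarithm along a path does not depend on the logarithm. -/
theorem exists_log_increment (f : I → ℂ) :
    ∃ ℓ : ℂ, ∀ F : I → ℂ, Continuous F → (∀ x, exp (F x) = f x) → F 1 - F 0 = ℓ := by
  by_cases h : ∃ F : I → ℂ, Continuous F ∧ ∀ x, exp (F x) = f x
  · obtain ⟨F, hF, hFf⟩ := h
    refine ⟨F 1 - F 0, fun F' hF' hFf' => ?_⟩
    -- Both sides lift the same map through the covering `exp` and agree at 0.
    have h1 : F' = fun x => F x + (F' 0 - F 0) := by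
      refine isCoveringMap_exp.eq_of_comp_eq hF' (by fun_prop) ?_ 0 (by simp)
      funext x
      apply Subtype.ext
      have : f 0 ≠ 0 := by rw [← hFf]; exact exp_ne_zero _
      simp [exp_add, exp_sub, hFf, hFf', this]
    have := congrFun h1 1
    rw [this]; ring
  -- Without a continuous logarithm the condition is vacuous, so 0 is an arbitrary value.
  · exact ⟨0, fun F h1 h2 => absurd ⟨F, h1, h2⟩ h⟩

/-- The logarithm of `-w` differs from that of `w` by an odd multiple of `π i`. -/
theorem exists_log_neg (w : ℂ) (hw : w ≠ 0) :
    ∃ n : ℤ, log w - log (-w) = Real.pi * Complex.I + n * (2 * Real.pi * Complex.I) := by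
  have h : exp (log w) = exp (log (-w) + Real.pi * Complex.I) := by
    rw [exp_add, exp_log hw, exp_log (neg_ne_zero.2 hw), exp_pi_mul_I]; ring
  obtain ⟨n, hn⟩ := exp_eq_exp_iff_exists_int.1 h
  exact ⟨n, by rw [hn]; ring⟩

/-- Parities of the crossings and turns of a family of arcs around points. -/
theorem exists_turnParity {W : Type*} (H : SimpleGraph W) (z : W → ℂ) (hz : z.Injective)
    (γ : ∀ u v, H.Adj u v → Path (z u) (z v))
    (hp : ∀ p u v (h : H.Adj u v), p ≠ u → p ≠ v → z p ∉ range (γ u v h))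
    (hd : ∀ u v x y (h : H.Adj u v) (k : H.Adj x y), u ≠ x → u ≠ y → v ≠ x → v ≠ y →
      Disjoint (range (γ u v h)) (range (γ x y k))) :
    ∃ (m : W → W → W → ZMod 2) (c : W → W → ZMod 2), (∀ u v, u ≠ v → c v u = 1 + c u v) ∧
      ∀ u v x y, H.Adj u v → H.Adj x y → u ≠ x → u ≠ y → v ≠ x → v ≠ y →
        m x u v + m y u v + m u x y + m v x y = c x u + c x v + c y u + c y v := by
  classical
  have hpi : (2 * Real.pi * Complex.I) ≠ 0 := by simp [Real.pi_ne_zero]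
  have hc : ∀ u v, ∃ n : ℤ, u ≠ v →
      log (z v - z u) - log (z u - z v) = Real.pi * Complex.I + n * (2 * Real.pi * Complex.I) := by
    intro u v
    by_cases h : u = v
    · exact ⟨0, fun h' => absurd h h'⟩
    · obtain ⟨n, hn⟩ := exists_log_neg (z v - z u) (sub_ne_zero.2 (hz.ne (Ne.symm h)))
      exact ⟨n, fun _ => by rw [← hn, neg_sub]⟩
  choose c hc using hc
  have hc' : ∀ u v, u ≠ v → c v u = - 1 - c u v := by
    intro u v h
    have h1 := hc u v h
    have h2 := hc v u h.symm
    have h3 : ((c v u + c u v + 1 : ℤ) : ℂ) * (2 * Real.pi * Complex.I) = 0 := by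
      push_cast; linear_combination - h1 - h2
    have h4 : c v u + c u v + 1 = 0 := by
      rcases mul_eq_zero.1 h3 with h | h
      · exact_mod_cast h
      · exact absurd h hpi
    omega
  choose ℓ hℓ using exists_log_increment
  -- `k` compares the continuous logarithm along the arc, seen from `p`, with the principal one: a
  -- signed count of crossings of the branch cut.
  have hm : ∀ p u v, ∃ k : ℤ, ∀ h : H.Adj u v, p ≠ u → p ≠ v →
      ℓ (fun t => γ u v h t - z p) =
        log (z v - z p) - log (z u - z p) + k * (2 * Real.pi * Complex.I) := by
    intro p u v
    by_cases h : H.Adj u v ∧ p ≠ u ∧ p ≠ v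
    · obtain ⟨h, hu, hv⟩ := h
      have h0 : ∀ t, γ u v h t - z p ≠ 0 := fun t ht =>
        hp p u v h hu hv ⟨t, sub_eq_zero.1 ht⟩
      obtain ⟨F, hF, hFe⟩ := exists_continuous_exp_eq_square
        (fun x => γ u v h x.1 - z p) (by fun_prop) (fun x => h0 _)
      have h1 := hℓ (fun t => γ u v h t - z p) (fun t => F (t, 0)) (by fun_prop)
        (fun t => hFe _)
      have h2 : exp (F (1, 0) - F (0, 0)) = exp (log (z v - z p) - log (z u - z p)) := by
        rw [exp_sub, exp_sub, exp_log (sub_ne_zero.2 (hz.ne hv.symm)),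
          exp_log (sub_ne_zero.2 (hz.ne hu.symm)), hFe, hFe]
        simp
      obtain ⟨k, hk⟩ := exp_eq_exp_iff_exists_int.1 h2
      exact ⟨k, fun _ _ _ => by rw [← h1, ← hk]⟩
    · exact ⟨0, fun h1 h2 h3 => absurd ⟨h1, h2, h3⟩ h⟩
  choose m hm using hm
  refine ⟨fun p u v => m p u v, fun u v => c u v, fun u v h => ?_, ?_⟩
  · simp only [hc' u v h]
    push_cast
    generalize (c u v : ZMod 2) = a
    revert a; decide
  intro u v x y h k ux uy vx vy
  -- On the four sides of the square, `F` is a logarithm of one arc seen from an end of the other.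
  -- On two sides the difference has the opposite sign, which `π i` corrects. The increments of `F`
  -- cancel around the boundary.
  obtain ⟨F, hF, hFe⟩ := exists_continuous_exp_eq_square
    (fun s => γ u v h s.1 - γ x y k s.2) (by fun_prop)
    (fun s hs => (hd u v x y h k ux uy vx vy).ne_of_mem ⟨s.1, rfl⟩ ⟨s.2, rfl⟩ (sub_eq_zero.1 hs))
  have e1 := hℓ (fun t => γ u v h t - z x) (fun t => F (t, 0)) (by fun_prop)
    (fun t => by rw [hFe]; simp)
  have e2 := hℓ (fun t => γ u v h t - z y) (fun t => F (t, 1)) (by fun_prop)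
    (fun t => by rw [hFe]; simp)
  have e3 := hℓ (fun t => γ x y k t - z u) (fun t => F (0, t) + Real.pi * Complex.I) (by fun_prop)
    (fun t => by rw [exp_add, exp_pi_mul_I, hFe]; simp)
  have e4 := hℓ (fun t => γ x y k t - z v) (fun t => F (1, t) + Real.pi * Complex.I) (by fun_prop)
    (fun t => by rw [exp_add, exp_pi_mul_I, hFe]; simp)
  rw [hm x u v h ux.symm vx.symm] at e1
  rw [hm y u v h uy.symm vy.symm] at e2
  rw [hm u x y k ux uy] at e3
  rw [hm v x y k vx vy] at e4
  have c1 := hc x v vx.symm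
  have c2 := hc x u ux.symm
  have c3 := hc y v vy.symm
  have c4 := hc y u uy.symm
  have h3 : ((m x u v + m v x y - m u x y - m y u v + c x v - c x u - c y v + c y u : ℤ) : ℂ) *
      (2 * Real.pi * Complex.I) = 0 := by
    push_cast
    linear_combination (-1 : ℂ) * e1 - e4 + e3 + e2 - c1 + c2 + c3 - c4
  have h4 : m x u v + m v x y - m u x y - m y u v + c x v - c x u - c y v + c y u = 0 := by
    rcases mul_eq_zero.1 h3 with h | h
    · exact_mod_cast h
    · exact absurd h hpi
  have h5 := congrArg (Int.cast : ℤ → ZMod 2) h4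
  push_cast at h5
  grind

/-- The parities can be chosen independently of the direction in which an arc is traversed. -/
theorem exists_symmetric_turnParity {W : Type*} (H : SimpleGraph W) (z : W → ℂ)
    (hz : z.Injective) (γ : ∀ u v, H.Adj u v → Path (z u) (z v))
    (hp : ∀ p u v (h : H.Adj u v), p ≠ u → p ≠ v → z p ∉ range (γ u v h))
    (hd : ∀ u v x y (h : H.Adj u v) (k : H.Adj x y), u ≠ x → u ≠ y → v ≠ x → v ≠ y →
      Disjoint (range (γ u v h)) (range (γ x y k))) :
    ∃ (m : W → W → W → ZMod 2) (c : W → W → ZMod 2), (∀ p u v, m p u v = m p v u) ∧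
      (∀ u v, u ≠ v → c v u = 1 + c u v) ∧
      ∀ u v x y, H.Adj u v → H.Adj x y → u ≠ x → u ≠ y → v ≠ x → v ≠ y →
        m x u v + m y u v + m u x y + m v x y = c x u + c x v + c y u + c y v := by
  classical
  obtain ⟨m, c, hc, hm⟩ := exists_turnParity H z hz γ hp hd
  -- Every edge is oriented from its smaller to its larger end. The relation survives because it is
  -- invariant under swapping the ends of either edge.
  let _ : LinearOrder W := linearOrderOfSTO WellOrderingRel
  refine ⟨fun p u v => m p (min u v) (max u v), c, fun p u v => by simp only [min_comm, max_comm], hc,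
    fun u v x y h k ux uy vx vy => ?_⟩
  rcases le_total u v with huv | huv <;> rcases le_total x y with hxy | hxy <;>
    simp only [huv, hxy, min_eq_left, min_eq_right, max_eq_left, max_eq_right]
  · exact hm u v x y h k ux uy vx vy
  · linear_combination hm u v y x h k.symm uy ux vy vx
  · linear_combination hm v u x y h.symm k vx vy ux uy
  · linear_combination hm v u y x h.symm k.symm vy vx uy ux

end

/-! ### Turn parities of walks, without topology -/

namespace SimpleGraph

/-- Parities attached to the points and the edges of a graph, as obtained from turning numbers in
a drawing in which disjoint edges do not cross. -/
structure TurnParity {W : Type*} (H : SimpleGraph W) where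
  /-- the parity of the turn of an edge around a point -/
  turn : W → W → W → ZMod 2
  /-- the comparison of two points -/
  cmp : W → W → ZMod 2
  turn_comm : ∀ p u v, turn p u v = turn p v u
  cmp_comm : ∀ u v, u ≠ v → cmp v u = 1 + cmp u v
  turn_rel : ∀ u v x y, H.Adj u v → H.Adj x y → u ≠ x → u ≠ y → v ≠ x → v ≠ y →
    turn x u v + turn y u v + turn u x y + turn v x y = cmp x u + cmp x v + cmp y u + cmp y v

namespace TurnParity

variable {W : Type*} {H : SimpleGraph W} (T : H.TurnParity)

/-- The parity of the turn of a walk around a point. -/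
def walkTurn (p : W) : ∀ {u v : W}, H.Walk u v → ZMod 2
  | _, _, .nil => 0
  | u, _, .cons (v := v) _ w => T.turn p u v + walkTurn p w

@[simp]
theorem walkTurn_nil (p u : W) : T.walkTurn p (.nil : H.Walk u u) = 0 := rfl

@[simp]
theorem walkTurn_cons (p : W) {u v w : W} (h : H.Adj u v) (P : H.Walk v w) :
    T.walkTurn p (.cons h P) = T.turn p u v + T.walkTurn p P := rfl

@[simp]
theorem walkTurn_append (p : W) {u v w : W} (P : H.Walk u v) (Q : H.Walk v w) :
    T.walkTurn p (P.append Q) = T.walkTurn p P + T.walkTurn p Q := by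
  induction P with
  | nil => simp
  | cons h P ih => simp [ih, add_assoc]

@[simp]
theorem walkTurn_reverse (p : W) {u v : W} (P : H.Walk u v) :
    T.walkTurn p P.reverse = T.walkTurn p P := by
  induction P with
  | nil => simp
  | cons h P ih => simp [ih, T.turn_comm p, add_comm]

/-- The relations for the successive edges of `Q` are added. The terms at each inner vertex of `Q`
occur twice and vanish modulo 2. -/
theorem turn_walkTurn_rel {u v x y : W} (h : H.Adj u v) (Q : H.Walk x y)
    (hu : u ∉ Q.support) (hv : v ∉ Q.support) :
    T.turn x u v + T.turn y u v + T.walkTurn u Q + T.walkTurn v Q =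
      T.cmp x u + T.cmp x v + T.cmp y u + T.cmp y v := by
  induction Q with
  | nil => simp only [walkTurn_nil]; grind
  | @cons a b _ k Q ih =>
    rw [Walk.support_cons, List.mem_cons, not_or] at hu hv
    have h1 := ih hu.2 hv.2
    have h2 := T.turn_rel u v a b h k hu.1 (fun e => hu.2 (e ▸ Q.start_mem_support)) hv.1
      (fun e => hv.2 (e ▸ Q.start_mem_support))
    simp only [walkTurn_cons]
    grind

/-- The fundamental relation between the turns of two disjoint walks around the ends of each
other. -/
theorem walkTurn_rel {u v x y : W} (P : H.Walk u v) (Q : H.Walk x y)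
    (hd : P.support.Disjoint Q.support) :
    T.walkTurn x P + T.walkTurn y P + T.walkTurn u Q + T.walkTurn v Q =
      T.cmp x u + T.cmp x v + T.cmp y u + T.cmp y v := by
  induction P with
  | nil => simp only [walkTurn_nil]; grind
  | @cons a b _ k P ih =>
    rw [Walk.support_cons, List.disjoint_cons_left] at hd
    have h1 := ih hd.2
    have h2 := T.turn_walkTurn_rel k Q hd.1 (hd.2 P.start_mem_support)
    simp only [walkTurn_cons]
    grind

/-- A closed walk has the same turn around the two ends of a walk disjoint from it. -/
theorem walkTurn_eq_of_disjoint {u x y : W} (P : H.Walk u u) (Q : H.Walk x y)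
    (hd : P.support.Disjoint Q.support) : T.walkTurn x P = T.walkTurn y P := by
  -- Both ends of `P` are `u`, so the turns of `Q` and all `cmp` terms cancel in pairs.
  have := T.walkTurn_rel P Q hd
  grind

/-- In a subdivided complete graph on four vertices, the number of branch vertices around which
the triangle of the other three turns an odd number of times is odd. -/
theorem walkTurn_tetrahedron {v₁ v₂ v₃ v₄ : W} (P₁₂ : H.Walk v₁ v₂) (P₁₃ : H.Walk v₁ v₃)
    (P₁₄ : H.Walk v₁ v₄) (P₂₃ : H.Walk v₂ v₃) (P₂₄ : H.Walk v₂ v₄) (P₃₄ : H.Walk v₃ v₄)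
    (h₁ : P₁₂.support.Disjoint P₃₄.support) (h₂ : P₁₃.support.Disjoint P₂₄.support)
    (h₃ : P₁₄.support.Disjoint P₂₃.support) :
    (T.walkTurn v₁ P₂₃ + T.walkTurn v₁ P₂₄ + T.walkTurn v₁ P₃₄) +
    (T.walkTurn v₂ P₁₃ + T.walkTurn v₂ P₁₄ + T.walkTurn v₂ P₃₄) +
    (T.walkTurn v₃ P₁₂ + T.walkTurn v₃ P₁₄ + T.walkTurn v₃ P₂₄) +
    (T.walkTurn v₄ P₁₂ + T.walkTurn v₄ P₁₃ + T.walkTurn v₄ P₂₃) = 1 := by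
  -- In the sum of the three relations, each comparison with `v₁` occurs twice in the same order.
  -- Each of the three pairs among `v₂, v₃, v₄` occurs once in either order and contributes 1.
  have r₁ := T.walkTurn_rel P₁₂ P₃₄ h₁
  have r₂ := T.walkTurn_rel P₁₃ P₂₄ h₂
  have r₃ := T.walkTurn_rel P₁₄ P₂₃ h₃
  have n₂₃ : v₂ ≠ v₃ := fun e => h₁ P₁₂.end_mem_support (e ▸ P₃₄.start_mem_support)
  have n₂₄ : v₂ ≠ v₄ := fun e => h₁ P₁₂.end_mem_support (e ▸ P₃₄.end_mem_support)
  have n₃₄ : v₃ ≠ v₄ := fun e => h₂ P₁₃.end_mem_support (e ▸ P₂₄.end_mem_support)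
  have n₁₂ : v₁ ≠ v₂ := fun e => h₂ P₁₃.start_mem_support (e ▸ P₂₄.start_mem_support)
  have n₁₃ : v₁ ≠ v₃ := fun e => h₁ P₁₂.start_mem_support (e ▸ P₃₄.start_mem_support)
  have n₁₄ : v₁ ≠ v₄ := fun e => h₁ P₁₂.start_mem_support (e ▸ P₃₄.end_mem_support)
  have c₂₃ := T.cmp_comm _ _ n₂₃
  have c₂₄ := T.cmp_comm _ _ n₂₄
  have c₃₄ := T.cmp_comm _ _ n₃₄
  have c₁₂ := T.cmp_comm _ _ n₁₂
  have c₁₃ := T.cmp_comm _ _ n₁₃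
  have c₁₄ := T.cmp_comm _ _ n₁₄
  grind

/-- Two points joined by disjoint walks to the two ends of one of two alternating pairs on a cycle
lie on different sides of the cycle. -/
theorem walkTurn_alternating {a₁ b₁ a₂ b₂ x y : W} (D₁ : H.Walk a₁ b₁) (D₂ : H.Walk b₁ a₂)
    (D₃ : H.Walk a₂ b₂) (D₄ : H.Walk b₂ a₁) (P₁ : H.Walk x a₁) (P₂ : H.Walk x a₂)
    (Q₁ : H.Walk y b₁) (Q₂ : H.Walk y b₂)
    (h₁₃ : D₁.support.Disjoint D₃.support) (h₂₄ : D₂.support.Disjoint D₄.support)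
    (p₁₂ : P₁.support.Disjoint D₂.support) (p₁₃ : P₁.support.Disjoint D₃.support)
    (p₂₁ : P₂.support.Disjoint D₁.support) (p₂₄ : P₂.support.Disjoint D₄.support)
    (q₁₃ : Q₁.support.Disjoint D₃.support) (q₁₄ : Q₁.support.Disjoint D₄.support)
    (q₂₁ : Q₂.support.Disjoint D₁.support) (q₂₂ : Q₂.support.Disjoint D₂.support)
    (k₁₁ : P₁.support.Disjoint Q₁.support) (k₁₂ : P₁.support.Disjoint Q₂.support)
    (k₂₁ : P₂.support.Disjoint Q₁.support) (k₂₂ : P₂.support.Disjoint Q₂.support) :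
    (T.walkTurn x D₁ + T.walkTurn x D₂ + T.walkTurn x D₃ + T.walkTurn x D₄) +
      (T.walkTurn y D₁ + T.walkTurn y D₂ + T.walkTurn y D₃ + T.walkTurn y D₄) = 1 := by
  -- The branch vertices are `a₁, b₁, a₂, b₂`, with the diagonals running through `x` and `y`.
  -- Below, the turn of each triangle is moved from its opposite branch vertex to `x` or `y`. The
  -- two triangles moved to the same point share a diagonal, which cancels and leaves the whole
  -- cycle.
  have h := T.walkTurn_tetrahedron D₁ (P₁.reverse.append P₂) D₄.reverse D₂
    (Q₁.reverse.append Q₂) D₃ h₁₃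
    (by
      intro
      simp only [Walk.mem_support_append_iff, Walk.support_reverse, List.mem_reverse]
      grind [List.Disjoint])
    (by intro; simp only [Walk.support_reverse, List.mem_reverse]; grind [List.Disjoint])
  have e₁ := T.walkTurn_eq_of_disjoint ((D₁.append D₂).append (P₂.reverse.append P₁)) Q₂
    (by
      intro
      simp only [Walk.mem_support_append_iff, Walk.support_reverse, List.mem_reverse]
      grind [List.Disjoint])
  have e₂ := T.walkTurn_eq_of_disjoint ((D₃.append D₄).append (P₁.reverse.append P₂)) Q₁
    (by
      intro
      simp only [Walk.mem_support_append_iff, Walk.support_reverse, List.mem_reverse]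
      grind [List.Disjoint])
  have e₃ := T.walkTurn_eq_of_disjoint ((D₂.append D₃).append (Q₂.reverse.append Q₁)) P₁
    (by
      intro
      simp only [Walk.mem_support_append_iff, Walk.support_reverse, List.mem_reverse]
      grind [List.Disjoint])
  have e₄ := T.walkTurn_eq_of_disjoint ((D₄.append D₁).append (Q₁.reverse.append Q₂)) P₂
    (by
      intro
      simp only [Walk.mem_support_append_iff, Walk.support_reverse, List.mem_reverse]
      grind [List.Disjoint])
  simp only [walkTurn_append, walkTurn_reverse] at h e₁ e₂ e₃ e₄
  grind

/-- Two points joined by disjoint fans to the same three points of a cycle lie on different sides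
of the cycle. -/
theorem walkTurn_fans {a b c x y : W} (D₁ : H.Walk a b) (D₂ : H.Walk b c)
    (D₃ : H.Walk c a) (P₁ : H.Walk x a) (P₂ : H.Walk x b) (P₃ : H.Walk x c)
    (Q₁ : H.Walk y a) (Q₂ : H.Walk y b) (Q₃ : H.Walk y c)
    (p₁ : P₁.support.Disjoint D₂.support) (p₂ : P₂.support.Disjoint D₃.support)
    (p₃ : P₃.support.Disjoint D₁.support)
    (q₁ : Q₁.support.Disjoint D₂.support) (q₂ : Q₂.support.Disjoint D₃.support)
    (q₃ : Q₃.support.Disjoint D₁.support)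
    (k₁₂ : P₁.support.Disjoint Q₂.support) (k₁₃ : P₁.support.Disjoint Q₃.support)
    (k₂₁ : P₂.support.Disjoint Q₁.support) (k₂₃ : P₂.support.Disjoint Q₃.support)
    (k₃₁ : P₃.support.Disjoint Q₁.support) (k₃₂ : P₃.support.Disjoint Q₂.support) :
    (T.walkTurn x D₁ + T.walkTurn x D₂ + T.walkTurn x D₃) +
      (T.walkTurn y D₁ + T.walkTurn y D₂ + T.walkTurn y D₃) = 1 := by
  -- The branch vertices are `x, a, b, c`. The three triangles through `x` are moved to `y`, where
  -- the paths from `x` cancel in pairs and the cycle remains.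
  have h := T.walkTurn_tetrahedron P₁ P₂ P₃ D₁ D₃.reverse D₂ p₁
    (by intro; simp only [Walk.support_reverse, List.mem_reverse]; grind [List.Disjoint]) p₃
  have e₁ := T.walkTurn_eq_of_disjoint (P₁.append (D₁.append P₂.reverse)) Q₃
    (by
      intro
      simp only [Walk.mem_support_append_iff, Walk.support_reverse, List.mem_reverse]
      grind [List.Disjoint])
  have e₂ := T.walkTurn_eq_of_disjoint (P₂.append (D₂.append P₃.reverse)) Q₁
    (by
      intro
      simp only [Walk.mem_support_append_iff, Walk.support_reverse, List.mem_reverse]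
      grind [List.Disjoint])
  have e₃ := T.walkTurn_eq_of_disjoint (P₃.append (D₃.append P₁.reverse)) Q₂
    (by
      intro
      simp only [Walk.mem_support_append_iff, Walk.support_reverse, List.mem_reverse]
      grind [List.Disjoint])
  simp only [walkTurn_append, walkTurn_reverse] at h e₁ e₂ e₃
  grind

end TurnParity

end SimpleGraph

/-! ### Turn parities of the subdivided graph from a plane drawing -/

section

open unitInterval

/-- The first half of an injective path, as a path that avoids the end. -/
theorem Path.exists_half {X : Type*} [TopologicalSpace X] {a b : X} (γ : Path a b)
    (hγ : Function.Injective γ) (c : X) (hc : c = γ ⟨1 / 2, by norm_num, by norm_num⟩) :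
    ∃ δ : Path a c, Set.range δ ⊆ Set.range γ ∧ b ∉ Set.range δ := by
  have hr : ∀ t : I, (t : ℝ) / 2 ∈ I := fun t => ⟨by linarith [t.2.1], by linarith [t.2.2]⟩
  let δ : Path a c :=
    { toFun := fun t => γ ⟨t / 2, hr t⟩
      continuous_toFun := by fun_prop
      source' := by simp
      target' := by rw [hc]; simp }
  refine ⟨δ, ?_, ?_⟩
  · rintro _ ⟨t, rfl⟩
    exact ⟨_, rfl⟩
  · rintro ⟨t, ht⟩
    have h1 : γ ⟨t / 2, hr t⟩ = γ 1 := by rw [γ.target]; exact ht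
    have h2 := congrArg Subtype.val (hγ h1)
    simp only [Set.Icc.coe_one] at h2
    linarith [t.2.2]

namespace SimpleGraph

variable {V : Type*}

/-- The incidence graph of a graph, which subdivides every edge once. -/
def incidenceGraph (G : SimpleGraph V) : SimpleGraph (V ⊕ G.edgeSet) where
  Adj
    | .inl v, .inr e => v ∈ (e : Sym2 V)
    | .inr e, .inl v => v ∈ (e : Sym2 V)
    | _, _ => False
  symm := ⟨by rintro (u | e) (v | f) h <;> exact h⟩
  loopless := ⟨by rintro (u | e) h <;> exact h⟩

/-- The midpoint of an arc represents the edge as a vertex of the incidence graph, so that even a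
chord has an interior point whose side can be measured. -/
theorem PlaneDrawing.exists_middle {G : SimpleGraph V} (D : G.PlaneDrawing) (e : G.edgeSet) :
    ∃ c ∈ D.arc e, (∀ w, D.point w ≠ c) ∧ ∀ v ∈ (e : Sym2 V), ∃ δ : _root_.Path (D.point v) c,
      Set.range δ ⊆ D.arc e ∧ ∀ w, D.point w ∈ Set.range δ → w = v := by
  obtain ⟨⟨a, b⟩, h⟩ := e
  have hab : G.Adj a b := h
  obtain ⟨γ, hγ, hr⟩ := D.exists_path a b hab
  have hr' : Set.range γ = D.arc ⟨Sym2.mk a b, h⟩ := hr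
  set m : I := ⟨1 / 2, by norm_num, by norm_num⟩ with hm
  have hm0 : m ≠ 0 := fun h => by simpa [hm] using congrArg Subtype.val h
  have hm1 : m ≠ 1 := fun h => by simpa [hm] using congrArg Subtype.val h
  have hmem : ∀ w, D.point w ∈ D.arc ⟨Sym2.mk a b, h⟩ → w = a ∨ w = b := fun w hw => by
    simpa using D.mem_of_point_mem w _ hw
  refine ⟨γ m, hr' ▸ ⟨m, rfl⟩, fun w hw => ?_, fun v hv => ?_⟩
  · rcases hmem w (by rw [hw, ← hr']; exact ⟨m, rfl⟩) with rfl | rfl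
    · exact hm0 (hγ (hw.symm.trans γ.source.symm))
    · exact hm1 (hγ (hw.symm.trans γ.target.symm))
  · have hv : v = a ∨ v = b := by simpa using hv
    rcases hv with rfl | rfl
    · obtain ⟨δ, h1, h2⟩ := γ.exists_half hγ (γ m) rfl
      refine ⟨δ, hr' ▸ h1, fun w hw => (hmem w (hr' ▸ h1 hw)).resolve_right ?_⟩
      rintro rfl
      exact h2 hw
    · have hs : Function.Injective γ.symm := fun s t hst => by
        simpa using hγ (by simpa using hst : γ (σ s) = γ (σ t))
      obtain ⟨δ, h1, h2⟩ := γ.symm.exists_half hs (γ m) (by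
        rw [_root_.Path.symm_apply]
        congr 1
        ext
        norm_num [hm])
      rw [_root_.Path.symm_range] at h1
      refine ⟨δ, hr' ▸ h1, fun w hw => (hmem w (hr' ▸ h1 hw)).resolve_left ?_⟩
      rintro rfl
      exact h2 hw

/-- Two half-arcs without common ends belong to different edges, so they could meet only at a drawn
vertex. Each half-arc contains just one drawn vertex, its own end, and these ends differ. -/
theorem PlaneDrawing.nonempty_turnParity {G : SimpleGraph V} (D : G.PlaneDrawing) :
    Nonempty G.incidenceGraph.TurnParity := by
  choose c hc hcp hδ using D.exists_middle
  let φ : EuclideanSpace ℝ (Fin 2) ≃ₜ ℂ :=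
    Complex.orthonormalBasisOneI.repr.symm.toHomeomorph
  let y : V ⊕ G.edgeSet → EuclideanSpace ℝ (Fin 2) := Sum.elim D.point c
  have hy : y.Injective := by
    rintro (u | e) (v | f) h
    · rw [D.point_injective h]
    · exact absurd h (hcp f u)
    · exact absurd h.symm (hcp e v)
    · by_contra hne
      have hef : e ≠ f := fun h => hne (by rw [h])
      have h' : c e = c f := h
      obtain ⟨w, -, -, hw⟩ := D.arc_inter e f hef (c e) ⟨hc e, h' ▸ hc f⟩
      exact hcp e w hw.symm
  have hγ : ∀ u v, G.incidenceGraph.Adj u v → ∃ γ : _root_.Path (y u) (y v), ∃ (a : V) (e : G.edgeSet),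
      (u = .inl a ∧ v = .inr e ∨ u = .inr e ∧ v = .inl a) ∧ Set.range γ ⊆ D.arc e ∧
        ∀ w, D.point w ∈ Set.range γ → w = a := by
    rintro (u | e) (v | f) h
    · exact h.elim
    · obtain ⟨δ, h1, h2⟩ := hδ f u h
      exact ⟨δ, u, f, Or.inl ⟨rfl, rfl⟩, h1, h2⟩
    · obtain ⟨δ, h1, h2⟩ := hδ e v h
      have h3 := _root_.Path.symm_range δ
      exact ⟨δ.symm, v, e, Or.inr ⟨rfl, rfl⟩, h3.le.trans h1, fun w hw => h2 w (h3.le hw)⟩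
    · exact h.elim
  choose γ hγ using hγ
  have hinj := φ.injective
  have hpt : ∀ p u v (h : G.incidenceGraph.Adj u v), p ≠ u → p ≠ v →
      (φ ∘ y) p ∉ Set.range ((γ u v h).map φ.continuous) := by
    rintro p u v h hu hv ⟨t, ht⟩
    have ht : γ u v h t = y p := hinj ht
    obtain ⟨a, e, hae, hγe, hγa⟩ := hγ u v h
    rcases p with w | f
    · have := hγa w ⟨t, ht⟩
      grind
    · obtain ⟨w, -, -, hw⟩ := D.arc_inter e f (by grind) (y (.inr f)) ⟨hγe ⟨t, ht⟩, hc f⟩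
      exact hcp f w hw.symm
  have hdis : ∀ u v x z (h : G.incidenceGraph.Adj u v) (k : G.incidenceGraph.Adj x z),
      u ≠ x → u ≠ z → v ≠ x → v ≠ z → Disjoint (Set.range ((γ u v h).map φ.continuous))
        (Set.range ((γ x z k).map φ.continuous)) := by
    intro u v x z h k ux uz vx vz
    rw [Set.disjoint_left]
    rintro _ ⟨t, rfl⟩ ⟨s, hs⟩
    have hs : γ x z k s = γ u v h t := hinj hs
    obtain ⟨a, e, hae, hγe, hγa⟩ := hγ u v h
    obtain ⟨b, f, hbf, hγf, hγb⟩ := hγ x z k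
    obtain ⟨w, -, -, hw⟩ := D.arc_inter e f (by grind) (γ u v h t) ⟨hγe ⟨t, rfl⟩, hγf ⟨s, hs⟩⟩
    have w1 := hγa w ⟨t, hw⟩
    have w2 := hγb w ⟨s, hs.trans hw⟩
    grind
  obtain ⟨m, cmp, h1, h2, h3⟩ := exists_symmetric_turnParity G.incidenceGraph (φ ∘ y)
    (hinj.comp hy) (fun u v h => (γ u v h).map φ.continuous) hpt hdis
  exact ⟨⟨m, cmp, h1, h2, h3⟩⟩

end SimpleGraph

end

/-! ### Positions and segments on the cycle -/

namespace SimpleGraph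

variable {V : Type*}

namespace Walk

variable {G : SimpleGraph V} {v₀ : V} {C : G.Walk v₀ v₀}

theorem IsCycle.getVert_inj (hC : C.IsCycle) {i j : ℕ} (hi : i < C.length) (hj : j < C.length)
    (h : C.getVert i = C.getVert j) : i = j :=
  hC.getVert_injOn' (by simp; omega) (by simp; omega) h

theorem exists_getVert_of_mem_support (hC : C.IsCycle) {v : V} (hv : v ∈ C.support) :
    ∃ i < C.length, C.getVert i = v := by
  obtain ⟨i, rfl, hi⟩ := mem_support_iff_exists_getVert.1 hv
  have := hC.three_le_length
  rcases hi.lt_or_eq with h | h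
  · exact ⟨i, h, rfl⟩
  · exact ⟨0, by omega, by rw [h]; simp⟩

theorem getElem_edges_eq_getVert (C : G.Walk v₀ v₀) (k : ℕ) (hk : k < C.length) :
    C.edges[k]'(by simpa using hk) = s(C.getVert k, C.getVert (k + 1)) := by
  simp only [edges, List.getElem_map]
  rw [darts_getElem_eq_getVert]
  rfl

theorem mem_edges_getVert (C : G.Walk v₀ v₀) (k : ℕ) (hk : k < C.length) :
    s(C.getVert k, C.getVert (k + 1)) ∈ C.edges := by
  rw [← C.getElem_edges_eq_getVert k hk]
  exact List.getElem_mem _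

theorem exists_getVert_of_mem_edges {e : Sym2 V} (he : e ∈ C.edges) :
    ∃ k < C.length, e = s(C.getVert k, C.getVert (k + 1)) := by
  obtain ⟨k, hk, rfl⟩ := List.getElem_of_mem he
  have hk' : k < C.length := by simpa using hk
  exact ⟨k, hk', C.getElem_edges_eq_getVert k hk'⟩

theorem IsCycle.edge_inj (hC : C.IsCycle) {i j : ℕ} (hi : i < C.length) (hj : j < C.length)
    (h : s(C.getVert i, C.getVert (i + 1)) = s(C.getVert j, C.getVert (j + 1))) : i = j := by
  rw [← C.getElem_edges_eq_getVert i hi, ← C.getElem_edges_eq_getVert j hj] at h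
  exact (hC.isTrail.edges_nodup.getElem_inj_iff).1 h

/-- The edges of a cycle join cyclically consecutive vertices. -/
theorem IsCycle.eq_succ_of_mem_edges (hC : C.IsCycle) {i j : ℕ} (hij : i < j) (hj : j < C.length)
    (h : s(C.getVert i, C.getVert j) ∈ C.edges) : j = i + 1 ∨ i = 0 ∧ j + 1 = C.length := by
  obtain ⟨k, hk, he⟩ := exists_getVert_of_mem_edges h
  have hw : ∃ k' < C.length, C.getVert (k + 1) = C.getVert k' ∧
      (k' = k + 1 ∨ k + 1 = C.length ∧ k' = 0) := by
    rcases (show k + 1 ≤ C.length from hk).lt_or_eq with h | h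
    · exact ⟨k + 1, h, rfl, Or.inl rfl⟩
    · exact ⟨0, by omega, by rw [h]; simp, Or.inr ⟨h, rfl⟩⟩
  obtain ⟨k', hk', hv, hkk⟩ := hw
  rw [hv, Sym2.eq_iff] at he
  rcases he with ⟨h1, h2⟩ | ⟨h1, h2⟩
  · have := hC.getVert_inj (hij.trans hj) hk h1
    have := hC.getVert_inj hj hk' h2
    omega
  · have := hC.getVert_inj (hij.trans hj) hk' h1
    have := hC.getVert_inj hj hk h2
    omega

/-- A vertex or an edge of a cycle occurs at a position, the even positions being those of the
vertices. -/
def At (C : G.Walk v₀ v₀) (z : V ⊕ G.edgeSet) (t : ℕ) : Prop :=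
  ∃ k < C.length, t = 2 * k ∧ z = .inl (C.getVert k) ∨
    t = 2 * k + 1 ∧ ∃ e : G.edgeSet, z = .inr e ∧ (e : Sym2 V) = s(C.getVert k, C.getVert (k + 1))

theorem IsCycle.at_unique (hC : C.IsCycle) {z : V ⊕ G.edgeSet} {t t' : ℕ} (h : C.At z t)
    (h' : C.At z t') : t = t' := by
  obtain ⟨k, hk, ⟨rfl, rfl⟩ | ⟨rfl, e, rfl, he⟩⟩ := h <;>
    obtain ⟨l, hl, ⟨rfl, h⟩ | ⟨rfl, f, h, hf⟩⟩ := h'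
  · rw [hC.getVert_inj hk hl (Sum.inl_injective h)]
  · cases h
  · cases h
  · obtain rfl := Sum.inr_injective h
    rw [hC.edge_inj hk hl (he ▸ hf)]

/-- The parity of the turn of one edge of a closed walk around a point. -/
noncomputable def stepTurn (C : G.Walk v₀ v₀) (T : G.incidenceGraph.TurnParity)
    (p : V ⊕ G.edgeSet) (k : ℕ) : ZMod 2 :=
  if h : k < C.length then
    T.turn p (.inl (C.getVert k)) (.inr ⟨s(C.getVert k, C.getVert (k + 1)), C.adj_getVert_succ h⟩) +
    T.turn p (.inr ⟨s(C.getVert k, C.getVert (k + 1)), C.adj_getVert_succ h⟩)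
      (.inl (C.getVert (k + 1)))
  else 0

/-- The alternative `t = 0` is needed because the last vertex `C.getVert C.length` is the initial
one and has position 0, not `2 * C.length`. -/
theorem IsCycle.exists_segment (hC : C.IsCycle) (T : G.incidenceGraph.TurnParity) {i j : ℕ}
    (hij : i ≤ j) (hj : j ≤ C.length) :
    ∃ P : G.incidenceGraph.Walk (.inl (C.getVert i)) (.inl (C.getVert j)),
      (∀ p, T.walkTurn p P = ∑ k ∈ Finset.Ico i j, C.stepTurn T p k) ∧
      ∀ z ∈ P.support, ∃ t, C.At z t ∧ (2 * i ≤ t ∧ t ≤ 2 * j ∨ j = C.length ∧ t = 0) := by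
  have hat : ∀ k ≤ C.length, ∃ t, C.At (.inl (C.getVert k)) t ∧
      (t = 2 * k ∨ k = C.length ∧ t = 0) := by
    intro k hk
    rcases hk.lt_or_eq with h | h
    · exact ⟨2 * k, ⟨k, h, Or.inl ⟨rfl, rfl⟩⟩, Or.inl rfl⟩
    · have := hC.three_le_length
      exact ⟨0, ⟨0, by omega, Or.inl ⟨rfl, by rw [h]; simp⟩⟩, Or.inr ⟨h, rfl⟩⟩
  induction j, hij using Nat.le_induction with
  | base =>
    refine ⟨.nil, by simp, fun z hz => ?_⟩
    obtain ⟨t, h1, h2⟩ := hat i hj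
    have : z = .inl (C.getVert i) := by simpa using hz
    exact ⟨t, this ▸ h1, by omega⟩
  | succ j hij ih =>
    obtain ⟨P, h1, h2⟩ := ih (by omega)
    have hj' : j < C.length := hj
    let e : G.edgeSet := ⟨s(C.getVert j, C.getVert (j + 1)), C.adj_getVert_succ hj'⟩
    have a1 : G.incidenceGraph.Adj (.inl (C.getVert j)) (.inr e) := Sym2.mem_mk_left _ _
    have a2 : G.incidenceGraph.Adj (.inr e) (.inl (C.getVert (j + 1))) := Sym2.mem_mk_right _ _
    refine ⟨P.append (.cons a1 (.cons a2 .nil)), fun p => ?_, fun z hz => ?_⟩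
    · rw [Finset.sum_Ico_succ_top hij, T.walkTurn_append, h1]
      simp [stepTurn, hj', e]
    · rw [Walk.mem_support_append_iff] at hz
      simp only [support_cons, support_nil, List.mem_cons, List.not_mem_nil, or_false] at hz
      rcases hz with hz | rfl | rfl | rfl
      · obtain ⟨t, h3, h4⟩ := h2 z hz
        exact ⟨t, h3, by omega⟩
      · exact ⟨2 * j, ⟨j, hj', Or.inl ⟨rfl, rfl⟩⟩, by omega⟩
      · exact ⟨2 * j + 1, ⟨j, hj', Or.inr ⟨rfl, e, rfl, rfl⟩⟩, by omega⟩
      · obtain ⟨t, h3, h4⟩ := hat (j + 1) hj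
        exact ⟨t, h3, by omega⟩

/-! ### Components off the cycle and interiors of bridges -/

namespace IsOffComponent

variable {X Y : Set V}

theorem notMem_support (hX : C.IsOffComponent X) {x : V} (hx : x ∈ X) : x ∉ C.support := by
  obtain ⟨K, rfl⟩ := hX
  obtain ⟨y, -, rfl⟩ := hx
  exact y.2

theorem nonempty (hX : C.IsOffComponent X) : X.Nonempty := by
  obtain ⟨K, rfl⟩ := hX
  exact K.nonempty_supp.image _

theorem mem_of_adj (hX : C.IsOffComponent X) {x y : V} (hx : x ∈ X) (hy : y ∉ C.support)
    (h : G.Adj x y) : y ∈ X := by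
  obtain ⟨K, rfl⟩ := hX
  obtain ⟨x, hx, rfl⟩ := hx
  exact ⟨⟨y, hy⟩, K.mem_supp_of_adj_mem_supp hx h, rfl⟩

theorem eq_of_mem (hX : C.IsOffComponent X) (hY : C.IsOffComponent Y) {x : V} (hx : x ∈ X)
    (hy : x ∈ Y) : X = Y := by
  obtain ⟨K, rfl⟩ := hX
  obtain ⟨L, rfl⟩ := hY
  obtain ⟨x, hx, rfl⟩ := hx
  obtain ⟨y, hy, hxy⟩ := hy
  obtain rfl := Subtype.ext hxy
  rw [← (show _ = K from hx), ← (show _ = L from hy)]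

end IsOffComponent

theorem exists_isOffComponent {v : V} (hv : v ∉ C.support) : ∃ X, C.IsOffComponent X ∧ v ∈ X :=
  ⟨_, ⟨(G.induce {w | w ∉ C.support}).connectedComponentMk ⟨v, hv⟩, rfl⟩, ⟨v, hv⟩, rfl, rfl⟩

/-- The points of the incidence graph that belong to the interior of a bridge. -/
def IsBridgeInterior (C : G.Walk v₀ v₀) (B : G.Subgraph) (S : Set (V ⊕ G.edgeSet)) : Prop :=
  (∃ X : Set V, C.IsOffComponent X ∧ B = (⊤ : G.Subgraph).induce (X ∪ C.adjacentOn X) ∧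
    S = {z | ∃ v ∈ X, z = .inl v ∨ ∃ e : G.edgeSet, v ∈ (e : Sym2 V) ∧ z = .inr e}) ∨
  (∃ (a b : V) (h : G.Adj a b), C.IsChord s(a, b) ∧ B = G.subgraphOfAdj h ∧
    S = {.inr ⟨s(a, b), h⟩})

theorem mem_attachments_of_component {X : Set V} (hX : C.IsOffComponent X) {a : V} :
    a ∈ C.attachments ((⊤ : G.Subgraph).induce (X ∪ C.adjacentOn X)) ↔ a ∈ C.adjacentOn X := by
  simp only [attachments, Subgraph.induce_verts, Set.mem_ofPred_eq, Set.mem_union]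
  exact ⟨fun h => h.1.resolve_left fun hx => hX.notMem_support hx h.2, fun h => ⟨Or.inr h, h.1⟩⟩

theorem mem_attachments_of_chord {a b v : V} (h : G.Adj a b) (hc : C.IsChord s(a, b)) :
    v ∈ C.attachments (G.subgraphOfAdj h) ↔ v = a ∨ v = b := by
  obtain ⟨-, -, ha, hb⟩ := isChord_sym2Mk.1 hc
  simp only [attachments, subgraphOfAdj_verts, Set.mem_ofPred_eq, Set.mem_insert_iff,
    Set.mem_singleton_iff]
  constructor
  · exact fun h => h.1
  · rintro (rfl | rfl) <;> simp [ha, hb]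

theorem IsOffComponent.exists_walk {X : Set V} (hX : C.IsOffComponent X) {x y : V} (hx : x ∈ X)
    (hy : y ∈ X) : ∃ P : G.incidenceGraph.Walk (.inl x) (.inl y), ∀ z ∈ P.support,
      ∃ v ∈ X, z = .inl v ∨ ∃ e : G.edgeSet, v ∈ (e : Sym2 V) ∧ z = .inr e := by
  obtain ⟨K, hK⟩ := id hX
  have key : ∀ u v : {w | w ∉ C.support}, ∀ P : (G.induce {w | w ∉ C.support}).Walk u v,
      u.1 ∈ X → ∃ P : G.incidenceGraph.Walk (.inl u.1) (.inl v.1), ∀ z ∈ P.support,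
      ∃ v ∈ X, z = .inl v ∨ ∃ e : G.edgeSet, v ∈ (e : Sym2 V) ∧ z = .inr e := by
    intro u v P hu
    induction P with
    | nil => exact ⟨.nil, fun z hz => ⟨_, hu, Or.inl (by simpa using hz)⟩⟩
    | @cons a b _ h P ih =>
      have hab : G.Adj a.1 b.1 := h
      obtain ⟨Q, hQ⟩ := ih (hX.mem_of_adj hu b.2 hab)
      let e : G.edgeSet := ⟨s(a.1, b.1), hab⟩
      have a1 : G.incidenceGraph.Adj (.inl a.1) (.inr e) := Sym2.mem_mk_left _ _
      have a2 : G.incidenceGraph.Adj (.inr e) (.inl b.1) := Sym2.mem_mk_right _ _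
      refine ⟨.cons a1 (.cons a2 Q), fun z hz => ?_⟩
      simp only [support_cons, List.mem_cons] at hz
      rcases hz with rfl | rfl | hz
      · exact ⟨a, hu, Or.inl rfl⟩
      · exact ⟨a, hu, Or.inr ⟨e, a1, rfl⟩⟩
      · exact hQ z hz
  subst hK
  obtain ⟨x, hx', rfl⟩ := id hx
  obtain ⟨y, hy', rfl⟩ := hy
  obtain ⟨P⟩ := ConnectedComponent.exact
    ((show _ = K from hx').trans (show _ = K from hy').symm)
  exact key x y P hx

/-- The interior of a bridge contains a point that is joined within the interior to all points of
attachment. -/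
theorem IsCycleBridge.exists_interior {B : G.Subgraph} (hB : C.IsCycleBridge B) :
    ∃ S, C.IsBridgeInterior B S ∧ ∃ x ∈ S, ∀ a ∈ C.attachments B,
      ∃ P : G.incidenceGraph.Walk x (.inl a), ∀ z ∈ P.support, z ∈ S ∨ z = .inl a := by
  rcases hB with ⟨X, hX, rfl⟩ | ⟨a, b, h, hc, rfl⟩
  · refine ⟨_, Or.inl ⟨X, hX, rfl, rfl⟩, ?_⟩
    obtain ⟨x, hx⟩ := hX.nonempty
    refine ⟨.inl x, ⟨x, hx, Or.inl rfl⟩, fun a ha => ?_⟩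
    obtain ⟨-, y, hy, hya⟩ := (mem_attachments_of_component hX).1 ha
    obtain ⟨P, hP⟩ := hX.exists_walk hx hy
    let e : G.edgeSet := ⟨s(y, a), hya⟩
    have a1 : G.incidenceGraph.Adj (.inl y) (.inr e) := Sym2.mem_mk_left _ _
    have a2 : G.incidenceGraph.Adj (.inr e) (.inl a) := Sym2.mem_mk_right _ _
    refine ⟨P.append (.cons a1 (.cons a2 .nil)), fun z hz => ?_⟩
    rw [Walk.mem_support_append_iff] at hz
    simp only [support_cons, support_nil, List.mem_cons, List.not_mem_nil, or_false] at hz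
    rcases hz with hz | rfl | rfl | rfl
    · exact Or.inl (hP z hz)
    · exact Or.inl ⟨y, hy, Or.inl rfl⟩
    · exact Or.inl ⟨y, hy, Or.inr ⟨e, a1, rfl⟩⟩
    · exact Or.inr rfl
  · refine ⟨_, Or.inr ⟨a, b, h, hc, rfl, rfl⟩, .inr ⟨s(a, b), h⟩, rfl, fun v hv => ?_⟩
    have a1 : G.incidenceGraph.Adj (.inr ⟨s(a, b), h⟩) (.inl v) :=
      Sym2.mem_iff.2 ((mem_attachments_of_chord h hc).1 hv)
    exact ⟨.cons a1 .nil, fun z hz => by simpa using hz⟩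

/-- The interior of a bridge contains no point of the cycle. -/
theorem IsBridgeInterior.not_at {B : G.Subgraph} {S : Set (V ⊕ G.edgeSet)}
    (h : C.IsBridgeInterior B S) {z : V ⊕ G.edgeSet} (hz : z ∈ S) {t : ℕ} : ¬ C.At z t := by
  rintro ⟨k, hk, hkz⟩
  rcases h with ⟨X, hX, rfl, rfl⟩ | ⟨a, b, hab, hc, rfl, rfl⟩
  · obtain ⟨v, hv, hvz⟩ := hz
    have hv' := hX.notMem_support hv
    rcases hkz with ⟨-, rfl⟩ | ⟨-, e, rfl, he⟩
    · rcases hvz with h | ⟨f, -, h⟩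
      · rw [Sum.inl.injEq] at h
        exact hv' (h ▸ C.getVert_mem_support k)
      · cases h
    · rcases hvz with h | ⟨f, hf, h⟩
      · cases h
      · obtain rfl := Sum.inr_injective h
        rw [he, Sym2.mem_iff] at hf
        rcases hf with rfl | rfl <;> exact hv' (C.getVert_mem_support _)
  · obtain rfl : z = _ := hz
    rcases hkz with ⟨-, h⟩ | ⟨-, e, h, he⟩
    · cases h
    · obtain rfl := Sum.inr_injective h
      have he : s(a, b) = _ := he
      exact (isChord_sym2Mk.1 hc).2.1 (he ▸ C.mem_edges_getVert k hk)

/-- The interiors of distinct bridges are disjoint. -/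
theorem IsBridgeInterior.disjoint {B B' : G.Subgraph} {S S' : Set (V ⊕ G.edgeSet)}
    (h : C.IsBridgeInterior B S) (h' : C.IsBridgeInterior B' S') (hne : B ≠ B') :
    Disjoint S S' := by
  rw [Set.disjoint_left]
  intro z hz hz'
  apply hne
  have key : ∀ (X : Set V) (a b : V) (h : G.Adj a b), C.IsOffComponent X → C.IsChord s(a, b) →
      ¬ ∃ v ∈ X, (.inr ⟨s(a, b), h⟩ : V ⊕ G.edgeSet) = .inl v ∨
        ∃ e : G.edgeSet, v ∈ (e : Sym2 V) ∧ (.inr ⟨s(a, b), h⟩ : V ⊕ G.edgeSet) = .inr e := by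
    rintro X a b h hX hc ⟨v, hv, h | ⟨e, he, h⟩⟩
    · cases h
    · obtain rfl := Sum.inr_injective h
      obtain ⟨-, -, ha, hb⟩ := isChord_sym2Mk.1 hc
      rcases Sym2.mem_iff.1 he with rfl | rfl
      · exact hX.notMem_support hv ha
      · exact hX.notMem_support hv hb
  rcases h with ⟨X, hX, rfl, rfl⟩ | ⟨a, b, hab, hc, rfl, rfl⟩ <;>
    rcases h' with ⟨Y, hY, rfl, rfl⟩ | ⟨a', b', hab', hc', rfl, rfl⟩
  · suffices X = Y by rw [this]
    obtain ⟨v, hv, hvz⟩ := hz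
    obtain ⟨w, hw, hwz⟩ := hz'
    rcases hvz with rfl | ⟨e, he, rfl⟩
    · rcases hwz with h | ⟨f, -, h⟩
      · obtain rfl := Sum.inl_injective h
        exact hX.eq_of_mem hY hv hw
      · cases h
    · rcases hwz with h | ⟨f, hf, h⟩
      · cases h
      · obtain rfl := Sum.inr_injective h
        by_cases hvw : v = w
        · subst hvw
          exact hX.eq_of_mem hY hv hw
        -- An edge that meets both components in different vertices joins them.
        · have hadj : s(v, w) ∈ G.edgeSet := (Sym2.mem_and_mem_iff hvw).1 ⟨he, hf⟩ ▸ e.2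
          exact hX.eq_of_mem hY (hX.mem_of_adj hv (hY.notMem_support hw) hadj) hw
  · obtain rfl : z = _ := hz'
    exact absurd hz (key X a' b' hab' hX hc')
  · obtain rfl : z = _ := hz
    exact absurd hz' (key Y a b hab hY hc)
  · obtain rfl : z = _ := hz
    have h : (⟨s(a, b), hab⟩ : G.edgeSet) = ⟨s(a', b'), hab'⟩ := Sum.inr_injective hz'
    have h : s(a, b) = s(a', b') := congrArg Subtype.val h
    rcases Sym2.eq_iff.1 h with ⟨rfl, rfl⟩ | ⟨rfl, rfl⟩
    · rfl
    · exact subgraphOfAdj_symm hab'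

/-- Since positions are unique, disjointness of pieces of the cycle becomes arithmetic of positions.
-/
theorem disjoint_of_at (hC : C.IsCycle) {l l' : List (V ⊕ G.edgeSet)} {p q : ℕ → Prop}
    (hl : ∀ z ∈ l, ∃ t, C.At z t ∧ p t) (hl' : ∀ z ∈ l', ∃ t, C.At z t ∧ q t)
    (h : ∀ t, p t → ¬ q t) : l.Disjoint l' := by
  intro z hz hz'
  obtain ⟨t, ht, hp⟩ := hl z hz
  obtain ⟨t', ht', hq⟩ := hl' z hz'
  exact h t hp (hC.at_unique ht ht' ▸ hq)

theorem disjoint_of_interior_of_at (hC : C.IsCycle) {B : G.Subgraph} {S : Set (V ⊕ G.edgeSet)}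
    (hS : C.IsBridgeInterior B S) {l l' : List (V ⊕ G.edgeSet)} {i : ℕ} {q : ℕ → Prop}
    (hi : i < C.length) (hl : ∀ z ∈ l, z ∈ S ∨ z = .inl (C.getVert i))
    (hl' : ∀ z ∈ l', ∃ t, C.At z t ∧ q t) (h : ¬ q (2 * i)) : l.Disjoint l' := by
  intro z hz hz'
  obtain ⟨t', ht', hq⟩ := hl' z hz'
  rcases hl z hz with h1 | rfl
  · exact hS.not_at h1 ht'
  · exact h (hC.at_unique ht' ⟨i, hi, Or.inl ⟨rfl, rfl⟩⟩ ▸ hq)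

theorem disjoint_of_interior (hC : C.IsCycle) {B B' : G.Subgraph} {S S' : Set (V ⊕ G.edgeSet)}
    (hS : C.IsBridgeInterior B S) (hS' : C.IsBridgeInterior B' S') (hne : B ≠ B')
    {l l' : List (V ⊕ G.edgeSet)} {i j : ℕ} (hi : i < C.length) (hj : j < C.length) (hij : i ≠ j)
    (hl : ∀ z ∈ l, z ∈ S ∨ z = .inl (C.getVert i))
    (hl' : ∀ z ∈ l', z ∈ S' ∨ z = .inl (C.getVert j)) : l.Disjoint l' := by
  intro z hz hz'
  rcases hl z hz with h1 | rfl <;> rcases hl' _ hz' with h2 | h2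
  · exact Set.disjoint_left.1 (hS.disjoint hS' hne) h1 h2
  · subst h2
    exact hS.not_at h1 ⟨j, hj, Or.inl ⟨rfl, rfl⟩⟩
  · exact hS'.not_at h2 ⟨i, hi, Or.inl ⟨rfl, rfl⟩⟩
  · exact hij (hC.getVert_inj hi hj (Sum.inl_injective h2))

/-! ### Sides of the cycle and bipartiteness -/

/-- The part of a cycle that runs through its initial vertex. -/
theorem IsCycle.exists_outer_segment (hC : C.IsCycle) (T : G.incidenceGraph.TurnParity) {i j : ℕ}
    (hj : j ≤ C.length) (hi : i ≤ C.length) :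
    ∃ P : G.incidenceGraph.Walk (.inl (C.getVert j)) (.inl (C.getVert i)),
      (∀ p, T.walkTurn p P =
        ∑ k ∈ Finset.Ico j C.length, C.stepTurn T p k + ∑ k ∈ Finset.Ico 0 i, C.stepTurn T p k) ∧
      ∀ z ∈ P.support, ∃ t, C.At z t ∧ (2 * j ≤ t ∨ t ≤ 2 * i ∨ i = C.length ∧ t = 0) := by
  obtain ⟨P, hP, hPs⟩ := hC.exists_segment T hj le_rfl
  obtain ⟨Q, hQ, hQs⟩ := hC.exists_segment T (Nat.zero_le i) hi
  have h : (.inl (C.getVert C.length) : V ⊕ G.edgeSet) = .inl (C.getVert 0) := by simp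
  refine ⟨(P.copy rfl h).append Q, fun p => ?_, fun z hz => ?_⟩
  · rw [T.walkTurn_append, ← hP, ← hQ]
    congr 1
    have : ∀ (a b c : V ⊕ G.edgeSet) (P : G.incidenceGraph.Walk a b) (h : b = c),
        T.walkTurn p (P.copy rfl h) = T.walkTurn p P := by
      rintro a b _ P rfl
      rfl
    exact this _ _ _ P h
  · rw [Walk.mem_support_append_iff, support_copy] at hz
    rcases hz with hz | hz
    · obtain ⟨t, h1, h2⟩ := hPs z hz
      exact ⟨t, h1, by omega⟩
    · obtain ⟨t, h1, h2⟩ := hQs z hz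
      exact ⟨t, h1, by omega⟩

/-- The side of a closed walk on which a point lies. -/
noncomputable def side (C : G.Walk v₀ v₀) (T : G.incidenceGraph.TurnParity)
    (p : V ⊕ G.edgeSet) : ZMod 2 :=
  ∑ k ∈ Finset.Ico 0 C.length, C.stepTurn T p k

/-- The attachments cut the cycle into four segments, and paths through the two interiors supply the
rest of the configuration of `walkTurn_alternating`. -/
theorem side_add_side_of_alternating (hC : C.IsCycle) (T : G.incidenceGraph.TurnParity)
    {B B' : G.Subgraph} {S S' : Set (V ⊕ G.edgeSet)} (hS : C.IsBridgeInterior B S)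
    (hS' : C.IsBridgeInterior B' S') (hne : B ≠ B') {x y : V ⊕ G.edgeSet}
    (hx : ∀ a ∈ C.attachments B, ∃ P : G.incidenceGraph.Walk x (.inl a),
      ∀ z ∈ P.support, z ∈ S ∨ z = .inl a)
    (hy : ∀ a ∈ C.attachments B', ∃ P : G.incidenceGraph.Walk y (.inl a),
      ∀ z ∈ P.support, z ∈ S' ∨ z = .inl a)
    {i j k l : ℕ} (hij : i < j) (hjk : j < k) (hkl : k < l) (hl : l < C.length)
    (hi' : C.getVert i ∈ C.attachments B) (hj' : C.getVert j ∈ C.attachments B')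
    (hk' : C.getVert k ∈ C.attachments B) (hl' : C.getVert l ∈ C.attachments B') :
    C.side T x + C.side T y = 1 := by
  obtain ⟨D₁, d₁, s₁⟩ := hC.exists_segment T hij.le (by omega)
  obtain ⟨D₂, d₂, s₂⟩ := hC.exists_segment T hjk.le (by omega)
  obtain ⟨D₃, d₃, s₃⟩ := hC.exists_segment T hkl.le (by omega)
  obtain ⟨D₄, d₄, s₄⟩ := hC.exists_outer_segment T (i := i) hl.le (by omega)
  obtain ⟨P₁, p₁⟩ := hx _ hi'
  obtain ⟨P₂, p₂⟩ := hx _ hk'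
  obtain ⟨Q₁, q₁⟩ := hy _ hj'
  obtain ⟨Q₂, q₂⟩ := hy _ hl'
  have hi : i < C.length := by omega
  have hj : j < C.length := by omega
  have hk : k < C.length := by omega
  have h := T.walkTurn_alternating D₁ D₂ D₃ D₄ P₁ P₂ Q₁ Q₂
    (disjoint_of_at hC s₁ s₃ (by omega)) (disjoint_of_at hC s₂ s₄ (by omega))
    (disjoint_of_interior_of_at hC hS hi p₁ s₂ (by omega))
    (disjoint_of_interior_of_at hC hS hi p₁ s₃ (by omega))
    (disjoint_of_interior_of_at hC hS hk p₂ s₁ (by omega))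
    (disjoint_of_interior_of_at hC hS hk p₂ s₄ (by omega))
    (disjoint_of_interior_of_at hC hS' hj q₁ s₃ (by omega))
    (disjoint_of_interior_of_at hC hS' hj q₁ s₄ (by omega))
    (disjoint_of_interior_of_at hC hS' hl q₂ s₁ (by omega))
    (disjoint_of_interior_of_at hC hS' hl q₂ s₂ (by omega))
    (disjoint_of_interior hC hS hS' hne hi hj (by omega) p₁ q₁)
    (disjoint_of_interior hC hS hS' hne hi hl (by omega) p₁ q₂)
    (disjoint_of_interior hC hS hS' hne hk hj (by omega) p₂ q₁)
    (disjoint_of_interior hC hS hS' hne hk hl (by omega) p₂ q₂)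
  have hs : ∀ p, C.side T p =
      T.walkTurn p D₁ + T.walkTurn p D₂ + T.walkTurn p D₃ + T.walkTurn p D₄ := by
    intro p
    rw [d₁, d₂, d₃, d₄, Finset.sum_Ico_consecutive _ hij.le hjk.le,
      Finset.sum_Ico_consecutive _ (hij.trans hjk).le hkl.le, ← add_assoc,
      Finset.sum_Ico_consecutive _ (hij.trans (hjk.trans hkl)).le hl.le, add_comm,
      Finset.sum_Ico_consecutive _ (Nat.zero_le i) hi.le, side]
  rw [hs, hs]
  exact h

theorem side_add_side_of_common (hC : C.IsCycle) (T : G.incidenceGraph.TurnParity)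
    {B B' : G.Subgraph} {S S' : Set (V ⊕ G.edgeSet)} (hS : C.IsBridgeInterior B S)
    (hS' : C.IsBridgeInterior B' S') (hne : B ≠ B') {x y : V ⊕ G.edgeSet}
    (hx : ∀ a ∈ C.attachments B, ∃ P : G.incidenceGraph.Walk x (.inl a),
      ∀ z ∈ P.support, z ∈ S ∨ z = .inl a)
    (hy : ∀ a ∈ C.attachments B', ∃ P : G.incidenceGraph.Walk y (.inl a),
      ∀ z ∈ P.support, z ∈ S' ∨ z = .inl a)
    {i j k : ℕ} (hij : i < j) (hjk : j < k) (hk : k < C.length)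
    (hi' : C.getVert i ∈ C.attachments B ∩ C.attachments B')
    (hj' : C.getVert j ∈ C.attachments B ∩ C.attachments B')
    (hk' : C.getVert k ∈ C.attachments B ∩ C.attachments B') :
    C.side T x + C.side T y = 1 := by
  obtain ⟨D₁, d₁, s₁⟩ := hC.exists_segment T hij.le (by omega)
  obtain ⟨D₂, d₂, s₂⟩ := hC.exists_segment T hjk.le (by omega)
  obtain ⟨D₃, d₃, s₃⟩ := hC.exists_outer_segment T (i := i) hk.le (by omega)
  obtain ⟨P₁, p₁⟩ := hx _ hi'.1
  obtain ⟨P₂, p₂⟩ := hx _ hj'.1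
  obtain ⟨P₃, p₃⟩ := hx _ hk'.1
  obtain ⟨Q₁, q₁⟩ := hy _ hi'.2
  obtain ⟨Q₂, q₂⟩ := hy _ hj'.2
  obtain ⟨Q₃, q₃⟩ := hy _ hk'.2
  have hi : i < C.length := by omega
  have hj : j < C.length := by omega
  have h := T.walkTurn_fans D₁ D₂ D₃ P₁ P₂ P₃ Q₁ Q₂ Q₃
    (disjoint_of_interior_of_at hC hS hi p₁ s₂ (by omega))
    (disjoint_of_interior_of_at hC hS hj p₂ s₃ (by omega))
    (disjoint_of_interior_of_at hC hS hk p₃ s₁ (by omega))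
    (disjoint_of_interior_of_at hC hS' hi q₁ s₂ (by omega))
    (disjoint_of_interior_of_at hC hS' hj q₂ s₃ (by omega))
    (disjoint_of_interior_of_at hC hS' hk q₃ s₁ (by omega))
    (disjoint_of_interior hC hS hS' hne hi hj (by omega) p₁ q₂)
    (disjoint_of_interior hC hS hS' hne hi hk (by omega) p₁ q₃)
    (disjoint_of_interior hC hS hS' hne hj hi (by omega) p₂ q₁)
    (disjoint_of_interior hC hS hS' hne hj hk (by omega) p₂ q₃)
    (disjoint_of_interior hC hS hS' hne hk hi (by omega) p₃ q₁)
    (disjoint_of_interior hC hS hS' hne hk hj (by omega) p₃ q₂)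
  have hs : ∀ p, C.side T p = T.walkTurn p D₁ + T.walkTurn p D₂ + T.walkTurn p D₃ := by
    intro p
    rw [d₁, d₂, d₃, Finset.sum_Ico_consecutive _ hij.le hjk.le, ← add_assoc,
      Finset.sum_Ico_consecutive _ (hij.trans hjk).le hk.le, add_comm,
      Finset.sum_Ico_consecutive _ (Nat.zero_le i) hi.le, side]
  rw [hs, hs]
  exact h

/-- Three common points of attachment occur at three increasing positions. -/
theorem exists_lt_lt_of_three (hC : C.IsCycle) {A : Set V} (hA : A ⊆ {v | v ∈ C.support})
    {x y z : V} (hxy : x ≠ y) (hyz : y ≠ z) (hxz : x ≠ z) (hx : x ∈ A) (hy : y ∈ A) (hz : z ∈ A) :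
    ∃ i j k, i < j ∧ j < k ∧ k < C.length ∧ C.getVert i ∈ A ∧ C.getVert j ∈ A ∧
      C.getVert k ∈ A := by
  obtain ⟨i, hi, rfl⟩ := exists_getVert_of_mem_support hC (hA hx)
  obtain ⟨j, hj, rfl⟩ := exists_getVert_of_mem_support hC (hA hy)
  obtain ⟨k, hk, rfl⟩ := exists_getVert_of_mem_support hC (hA hz)
  have h1 : i ≠ j := fun h => hxy (by rw [h])
  have h2 : j ≠ k := fun h => hyz (by rw [h])
  have h3 : i ≠ k := fun h => hxz (by rw [h])
  rcases h1.lt_or_gt with h1 | h1 <;> rcases h2.lt_or_gt with h2 | h2 <;>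
    rcases h3.lt_or_gt with h3 | h3
  · exact ⟨i, j, k, h1, h2, hk, hx, hy, hz⟩
  · omega
  · exact ⟨i, k, j, h3, h2, hj, hx, hz, hy⟩
  · exact ⟨k, i, j, h3, h1, hj, hz, hx, hy⟩
  · exact ⟨j, i, k, h1, h3, hk, hy, hx, hz⟩
  · exact ⟨j, k, i, h2, h3, hi, hy, hz, hx⟩
  · omega
  · exact ⟨k, j, i, h2, h1, hi, hz, hy, hx⟩

/-- The conflict graph of a cycle in a planar graph is bipartite. -/
theorem isBipartite_conflictGraph (hG : G.IsPlanar) (hC : C.IsCycle) :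
    C.conflictGraph.IsBipartite := by
  obtain ⟨D⟩ := hG
  obtain ⟨T⟩ := D.nonempty_turnParity
  choose S hS x _ hx using fun B : {B : G.Subgraph // C.IsCycleBridge B} => B.2.exists_interior
  have key : ∀ B B', C.conflictGraph.Adj B B' → C.side T (x B) + C.side T (x B') = 1 := by
    rintro B B' ⟨hne, hc⟩
    have hne : B.1 ≠ B'.1 := fun h => hne (Subtype.ext h)
    rcases hc with ⟨i, j, k, l, hij, hjk, hkl, hl, ⟨h1, h2, h3, h4⟩ | ⟨h1, h2, h3, h4⟩⟩ |
      ⟨a, b, c, hab, hbc, hac, ha, hb, hc⟩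
    · exact side_add_side_of_alternating hC T (hS B) (hS B') hne (hx B) (hx B') hij hjk hkl hl
        h1 h2 h3 h4
    · rw [add_comm]
      exact side_add_side_of_alternating hC T (hS B') (hS B) hne.symm (hx B') (hx B) hij hjk hkl hl
        h1 h2 h3 h4
    · obtain ⟨i, j, k, hij, hjk, hk, h1, h2, h3⟩ :=
        exists_lt_lt_of_three hC (fun v hv => hv.1.2) hab hbc hac ha hb hc
      exact side_add_side_of_common hC T (hS B) (hS B') hne (hx B) (hx B') hij hjk hk h1 h2 h3
  -- The side is a color in `ZMod 2`, which unfolds to `Fin 2`.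
  refine ⟨Coloring.mk (fun B => (C.side T (x B) : ZMod 2)) fun {B B'} h heq => ?_⟩
  have h1 := key B B' h
  have heq : C.side T (x B) = C.side T (x B') := heq
  rw [heq] at h1
  generalize C.side T (x B') = s at h1
  revert s
  decide

end Walk

end SimpleGraph

/-! ### Connectedness from 3-connectivity -/

namespace SimpleGraph

variable {V : Type*}

/-- In a 3-connected graph, a set that contains a vertex and is closed under adjacency outside a
set of at most two vertices contains every other vertex outside that set. -/
theorem IsThreeConnected.mem_of_closed {G : SimpleGraph V} (hG : G.IsThreeConnected)
    {S : Finset V} (hS : S.card < 3) {U : Set V} (hU : ∀ v ∈ U, v ∉ S → ∀ w ∉ S, G.Adj v w → w ∈ U)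
    {u w : V} (hu : u ∈ U) (huS : u ∉ S) (hw : w ∉ S) : w ∈ U := by
  obtain ⟨P⟩ := (hG.2 S hS).preconnected ⟨u, huS⟩ ⟨w, hw⟩
  have key : ∀ a b : {v | v ∉ S}, (G.induce {v | v ∉ S}).Walk a b → a.1 ∈ U → b.1 ∈ U := by
    intro a b P
    induction P with
    | nil => exact id
    | @cons a b _ h P ih => exact fun ha => ih (hU a.1 ha a.2 b.1 b.2 h)
  exact key _ _ P hu

namespace Walk

variable {G : SimpleGraph V} {v₀ : V} {C : G.Walk v₀ v₀}

/-- Strictly between two positions. -/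
def Inner (lo hi t : ℕ) : Prop := lo < t ∧ t < hi

/-- Strictly outside two positions. -/
def Outer (lo hi t : ℕ) : Prop := t < lo ∨ hi < t

/-- Every pair of vertices that cuts a cycle into two nonempty parts is bypassed by a bridge. -/
theorem exists_bridge_across (hG : G.IsThreeConnected) (hC : C.IsCycle) {lo hi i j : ℕ}
    (hhi : hi < C.length) (hi' : Inner lo hi i) (hj : j < C.length) (hj' : Outer lo hi j) :
    ∃ B, C.IsCycleBridge B ∧ ∃ s t, s < C.length ∧ t < C.length ∧ Inner lo hi s ∧ Outer lo hi t ∧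
      C.getVert s ∈ C.attachments B ∧ C.getVert t ∈ C.attachments B := by
  classical
  by_contra hno
  simp only [not_exists, not_and] at hno
  unfold Inner Outer at *
  let S : Finset V := {C.getVert lo, C.getVert hi}
  have hS : S.card < 3 := Finset.card_le_two.trans_lt (by norm_num)
  -- `U` is the open inner arc with all components attached to it. If no bridge reaches from the
  -- inner to the outer arc, only `C.getVert lo` and `C.getVert hi` separate `U` from the outer arc.
  let U : Set V := {v | (∃ s, (lo < s ∧ s < hi) ∧ C.getVert s = v) ∨
    ∃ X, C.IsOffComponent X ∧ v ∈ X ∧ ∃ s, (lo < s ∧ s < hi) ∧ C.getVert s ∈ C.adjacentOn X}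
  have hpos : ∀ v ∈ C.support, v ∉ S → ∃ t < C.length, C.getVert t = v ∧
      ((lo < t ∧ t < hi) ∨ (t < lo ∨ hi < t)) := by
    intro v hv hvS
    obtain ⟨t, ht, rfl⟩ := exists_getVert_of_mem_support hC hv
    refine ⟨t, ht, rfl, ?_⟩
    have h1 : t ≠ lo := by rintro rfl; simp [S] at hvS
    have h2 : t ≠ hi := by rintro rfl; simp [S] at hvS
    omega
  have hnot : ∀ t < C.length, t ≠ lo → t ≠ hi → C.getVert t ∉ S := by
    intro t ht h1 h2 h
    simp only [S, Finset.mem_insert, Finset.mem_singleton] at h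
    rcases h with h | h
    · exact h1 (hC.getVert_inj ht (by omega) h)
    · exact h2 (hC.getVert_inj ht hhi h)
  have hcomp : ∀ X, C.IsOffComponent X → ∀ s t, (lo < s ∧ s < hi) → t < C.length →
      (t < lo ∨ hi < t) → C.getVert s ∈ C.adjacentOn X → C.getVert t ∉ C.adjacentOn X :=
    fun X hX s t hs ht ht' h1 h2 => hno _ (Or.inl ⟨X, hX, rfl⟩) s t (by omega) ht hs ht'
      ((mem_attachments_of_component hX).2 h1) ((mem_attachments_of_component hX).2 h2)
  have hU : ∀ v ∈ U, v ∉ S → ∀ w ∉ S, G.Adj v w → w ∈ U := by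
    intro v hv hvS w hwS hvw
    by_cases hw : w ∈ C.support
    · obtain ⟨t, ht, rfl, ht' | ht'⟩ := hpos w hw hwS
      · exact Or.inl ⟨t, ht', rfl⟩
      · exfalso
        rcases hv with ⟨s, hs, rfl⟩ | ⟨X, hX, hvX, s, hs, hsX⟩
        · by_cases he : s(C.getVert s, C.getVert t) ∈ C.edges
          · rcases lt_trichotomy s t with hst | hst | hst
            · have := hC.eq_succ_of_mem_edges hst ht he
              omega
            · omega
            · have := hC.eq_succ_of_mem_edges hst (by omega) (Sym2.eq_swap ▸ he)
              omega
          · have hc : C.IsChord s(C.getVert s, C.getVert t) :=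
              isChord_sym2Mk.2 ⟨hvw, he, C.getVert_mem_support _, C.getVert_mem_support _⟩
            exact hno _ (Or.inr ⟨_, _, hvw, hc, rfl⟩) s t (by omega) ht hs ht'
              ((mem_attachments_of_chord hvw hc).2 (Or.inl rfl))
              ((mem_attachments_of_chord hvw hc).2 (Or.inr rfl))
        · exact hcomp X hX s t hs ht ht' hsX ⟨hw, v, hvX, hvw⟩
    · rcases hv with ⟨s, hs, rfl⟩ | ⟨X, hX, hvX, hs⟩
      · obtain ⟨X, hX, hwX⟩ := exists_isOffComponent hw
        exact Or.inr ⟨X, hX, hwX, s, hs, C.getVert_mem_support _, w, hwX, hvw.symm⟩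
      · exact Or.inr ⟨X, hX, hX.mem_of_adj hvX hw hvw, hs⟩
  rcases hG.mem_of_closed hS hU (u := C.getVert i) (w := C.getVert j) (Or.inl ⟨i, hi', rfl⟩)
    (hnot i (by omega) (by omega) (by omega)) (hnot j hj (by omega) (by omega)) with
    ⟨s, hs, h⟩ | ⟨X, hX, hjX, -⟩
  · have := hC.getVert_inj (by omega) hj h
    omega
  · exact hX.notMem_support hjX (C.getVert_mem_support _)

/-- In a 3-connected graph, the bridge of a component has at least three points of attachment. -/
theorem IsOffComponent.exists_three_attachments (hG : G.IsThreeConnected) (hC : C.IsCycle)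
    {X : Set V} (hX : C.IsOffComponent X) :
    ∃ i j k, i < j ∧ j < k ∧ k < C.length ∧ C.getVert i ∈ C.adjacentOn X ∧
      C.getVert j ∈ C.adjacentOn X ∧ C.getVert k ∈ C.adjacentOn X := by
  classical
  let S : Finset V := C.support.toFinset.filter (· ∈ C.adjacentOn X)
  have hS : ∀ v, v ∈ S ↔ v ∈ C.adjacentOn X := fun v => by
    simp only [S, Finset.mem_filter, List.mem_toFinset, and_iff_right_iff_imp]
    exact fun h => h.1
  by_cases hcard : S.card < 3
  · exfalso
    have h3 := hC.three_le_length
    -- The cycle has at least three vertices, so fewer than three attachments would separate `X`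
    -- from a vertex `w` of `C`.
    obtain ⟨w, hw, hwS⟩ : ∃ w ∈ (Finset.range C.length).image C.getVert, w ∉ S := by
      apply Finset.exists_mem_notMem_of_card_lt_card
      rw [Finset.card_image_of_injOn, Finset.card_range]
      · omega
      · intro i hi j hj h
        exact hC.getVert_inj (by simpa using hi) (by simpa using hj) h
    obtain ⟨t, -, rfl⟩ := Finset.mem_image.1 hw
    obtain ⟨x, hx⟩ := hX.nonempty
    refine hX.notMem_support (hG.mem_of_closed hcard (U := X) (fun v hv _ w hwS hvw => ?_) hx
      (fun h => hX.notMem_support hx ((hS x).1 h).1) hwS) (C.getVert_mem_support t)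
    by_cases hw : w ∈ C.support
    · exact absurd ((hS w).2 ⟨hw, v, hv, hvw⟩) hwS
    · exact hX.mem_of_adj hv hw hvw
  · obtain ⟨a, b, c, ha, hb, hc, hab, hac, hbc⟩ := Finset.two_lt_card_iff.1 (not_lt.1 hcard)
    exact exists_lt_lt_of_three hC (fun v hv => hv.1) hab hbc hac ((hS a).1 ha) ((hS b).1 hb)
      ((hS c).1 hc)

/-- A bridge in a 3-connected graph has two attachments that are not consecutive on the cycle, or
it is attached to all vertices of a triangle. -/
theorem IsCycleBridge.exists_attachments (hG : G.IsThreeConnected) (hC : C.IsCycle)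
    {B : G.Subgraph} (hB : C.IsCycleBridge B) :
    (∃ i j, i + 1 < j ∧ j < C.length ∧ (i = 0 → j + 1 < C.length) ∧
      C.getVert i ∈ C.attachments B ∧ C.getVert j ∈ C.attachments B) ∨
    C.length = 3 ∧ ∀ i < C.length, C.getVert i ∈ C.attachments B := by
  rcases hB with ⟨X, hX, rfl⟩ | ⟨a, b, h, hc, rfl⟩
  · obtain ⟨i, j, k, hij, hjk, hk, h1, h2, h3⟩ := hX.exists_three_attachments hG hC
    rw [← mem_attachments_of_component hX] at h1 h2 h3
    -- The outermost two attachments are consecutive only across the start of the walk. Then the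
    -- middle one is nonconsecutive to one of them, unless the cycle is a triangle.
    by_cases h : i = 0 ∧ k + 1 = C.length
    · by_cases hij' : i + 1 < j
      · exact Or.inl ⟨i, j, hij', by omega, by omega, h1, h2⟩
      · by_cases hjk' : j + 1 < k
        · exact Or.inl ⟨j, k, hjk', by omega, by omega, h2, h3⟩
        · refine Or.inr ⟨by omega, fun t ht => ?_⟩
          obtain rfl | rfl | rfl : t = i ∨ t = j ∨ t = k := by omega
          all_goals assumption
    · exact Or.inl ⟨i, k, by omega, hk, by omega, h1, h3⟩
  · obtain ⟨-, he, ha, hb⟩ := isChord_sym2Mk.1 hc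
    have key : ∀ i j, i < j → j < C.length → s(C.getVert i, C.getVert j) ∉ C.edges →
        i + 1 < j ∧ j < C.length ∧ (i = 0 → j + 1 < C.length) := by
      intro i j hij hj he
      have h1 : j ≠ i + 1 := by
        rintro rfl
        exact he (C.mem_edges_getVert i (by omega))
      refine ⟨by omega, hj, ?_⟩
      rintro rfl
      by_contra hlt
      have h2 := C.mem_edges_getVert j hj
      rw [show j + 1 = C.length by omega, C.getVert_length, Sym2.eq_swap] at h2
      rw [C.getVert_zero] at he
      exact he h2
    have hab := mem_attachments_of_chord (v := a) h hc
    have hbb := mem_attachments_of_chord (v := b) h hc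
    obtain ⟨i, hi, rfl⟩ := exists_getVert_of_mem_support hC ha
    obtain ⟨j, hj, rfl⟩ := exists_getVert_of_mem_support hC hb
    rcases lt_trichotomy i j with hij | hij | hij
    · obtain ⟨h1, h2, h3⟩ := key i j hij hj he
      exact Or.inl ⟨i, j, h1, h2, h3, hab.2 (Or.inl rfl), hbb.2 (Or.inr rfl)⟩
    · exact absurd (by rw [hij]) h.ne
    · obtain ⟨h1, h2, h3⟩ := key j i hij hi (Sym2.eq_swap ▸ he)
      exact Or.inl ⟨j, i, h1, h2, h3, hbb.2 (Or.inr rfl), hab.2 (Or.inl rfl)⟩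

/-- A connected set of bridges none of which conflicts with a given bridge lies on one side of any
two attachments of that bridge. -/
theorem not_inner_and_outer_of_reachable (hC : C.IsCycle) {p q : ℕ}
    (hq : q < C.length) {D : {B : G.Subgraph // C.IsCycleBridge B}}
    (hp : C.getVert p ∈ C.attachments D.1) (hq' : C.getVert q ∈ C.attachments D.1)
    {B B' : {B : G.Subgraph // C.IsCycleBridge B}} (hD : ¬ C.conflictGraph.Reachable B D)
    (hBB' : C.conflictGraph.Reachable B B') {s t : ℕ} (hs : Inner p q s) (ht : Outer p q t)
    (htl : t < C.length) (hsB : C.getVert s ∈ C.attachments B.1)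
    (htB : C.getVert t ∈ C.attachments B'.1) : False := by
  unfold Inner Outer at *
  -- Attachments of `E` on both sides of `p, q` would interlace with those of `D`.
  have split : ∀ E, ¬ C.conflictGraph.Reachable E D → ∀ s t, (p < s ∧ s < q) → (t < p ∨ q < t) →
      t < C.length → C.getVert s ∈ C.attachments E.1 → C.getVert t ∈ C.attachments E.1 → False := by
    intro E hE s t hs ht htl h1 h2
    have hne : E ≠ D := by
      rintro rfl
      exact hE (Reachable.refl _)
    refine hE (Adj.reachable (show C.conflictGraph.Adj E D from ⟨hne, Or.inl ?_⟩))
    rcases ht with ht | ht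
    · exact ⟨t, p, s, q, ht, hs.1, hs.2, hq, Or.inl ⟨h2, hp, h1, hq'⟩⟩
    · exact ⟨p, s, q, t, hs.1, hs.2, ht, htl, Or.inr ⟨hp, h1, hq', h2⟩⟩
  -- If `F` had an outer attachment, it would have no inner one by `split`. Then `E` and `F` could
  -- share at most the attachments at `p` and `q`, and could not interlace, so they would not
  -- conflict.
  have step : ∀ E F, C.conflictGraph.Adj E F → ¬ C.conflictGraph.Reachable E D →
      (∀ t < C.length, (t < p ∨ q < t) → C.getVert t ∉ C.attachments E.1) →
      (∀ t < C.length, (t < p ∨ q < t) → C.getVert t ∉ C.attachments F.1) := by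
    intro E F hEF hE hEo u hul hu huF
    have hF : ¬ C.conflictGraph.Reachable F D := fun h => hE (hEF.reachable.trans h)
    have hFi : ∀ s, (p < s ∧ s < q) → C.getVert s ∉ C.attachments F.1 :=
      fun s hs hsF => split F hF s u hs hu hul hsF huF
    rcases hEF.2 with ⟨i, j, k, l, hij, hjk, hkl, hl, ⟨h1, h2, h3, h4⟩ | ⟨h1, h2, h3, h4⟩⟩ | h
    · have := hEo i (by omega)
      have := hEo k (by omega)
      have := hFi j
      grind
    · have := hEo j (by omega)
      have := hEo l (by omega)
      have := hFi k
      grind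
    · obtain ⟨a, b, c, hab, hbc, hac, ha, hb, hc⟩ := h
      obtain ⟨i, j, k, hij, hjk, hk, h1, h2, h3⟩ :=
        exists_lt_lt_of_three hC (fun v hv => hv.1.2) hab hbc hac ha hb hc
      by_cases hjo : j < p ∨ q < j
      · exact hEo j (by omega) hjo h2.1
      · by_cases hji : p < j ∧ j < q
        · exact hFi j hji h2.2
        · by_cases hjp : j = p
          · exact hEo i (by omega) (by omega) h1.1
          · exact hEo k hk (by omega) h3.1
  have key : ∀ E F, C.conflictGraph.Walk E F → ¬ C.conflictGraph.Reachable E D →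
      (∀ t < C.length, (t < p ∨ q < t) → C.getVert t ∉ C.attachments E.1) →
      (∀ t < C.length, (t < p ∨ q < t) → C.getVert t ∉ C.attachments F.1) := by
    intro E F P
    induction P with
    | nil => exact fun _ h => h
    | @cons E F _ h P ih =>
      exact fun hE hEo => ih (fun hF => hE (h.reachable.trans hF)) (step E F h hE hEo)
  obtain ⟨P⟩ := hBB'
  exact key B B' P hD (fun u hu hu' huB => split B hD s u hs hu' hu hsB huB) t htl ht htB

/-- On a cycle of length at least 4, some bridge bypasses the pair of positions 0 and 2. A triangle
misses a vertex, since there are more than three. -/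
theorem exists_isCycleBridge (hG : G.IsThreeConnected) (hC : C.IsCycle) :
    ∃ B, C.IsCycleBridge B := by
  have h3 := hC.three_le_length
  rcases h3.lt_or_eq with h | h
  · obtain ⟨B, hB, -⟩ := exists_bridge_across hG hC (lo := 0) (hi := 2) (i := 1) (j := 3)
      (by omega) ⟨by omega, by omega⟩ (by omega) (Or.inr (by omega))
    exact ⟨B, hB⟩
  · by_cases hv : ∃ v, v ∉ C.support
    · obtain ⟨v, hv⟩ := hv
      obtain ⟨X, hX, -⟩ := exists_isOffComponent hv
      exact ⟨_, Or.inl ⟨X, hX, rfl⟩⟩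
    · exfalso
      push Not at hv
      have hs : Function.Surjective fun i : Fin 3 => C.getVert i := by
        intro v
        obtain ⟨i, hi, rfl⟩ := exists_getVert_of_mem_support hC (hv v)
        exact ⟨⟨i, by omega⟩, rfl⟩
      have : Finite V := Finite.of_surjective _ hs
      have h1 := Nat.card_le_card_of_surjective _ hs
      have h2 := hG.1
      rw [ENat.card_eq_coe_natCard] at h2
      have h2 : 3 < Nat.card V := by exact_mod_cast h2
      simp at h1
      omega

/-- The bridges reachable from a given bridge in the conflict graph are attached to the whole
cycle. -/
theorem exists_reachable_attached (hG : G.IsThreeConnected) (hC : C.IsCycle)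
    (B₀ : {B : G.Subgraph // C.IsCycleBridge B}) {m : ℕ} (hm : m < C.length) :
    ∃ B, C.conflictGraph.Reachable B₀ B ∧ C.getVert m ∈ C.attachments B.1 := by
  classical
  let A : Finset ℕ := (Finset.range C.length).filter fun t =>
    ∃ B, C.conflictGraph.Reachable B₀ B ∧ C.getVert t ∈ C.attachments B.1
  have hA : ∀ t, t ∈ A ↔ t < C.length ∧
      ∃ B, C.conflictGraph.Reachable B₀ B ∧ C.getVert t ∈ C.attachments B.1 := fun t => by
    simp [A]
  suffices m ∈ A from ((hA m).1 this).2
  rcases B₀.2.exists_attachments hG hC with ⟨i, j, hij, hj, hij0, h1, h2⟩ | ⟨-, h⟩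
  swap
  · exact (hA m).2 ⟨hm, B₀, Reachable.refl _, h m hm⟩
  have hiA : i ∈ A := (hA i).2 ⟨by omega, B₀, Reachable.refl _, h1⟩
  have hjA : j ∈ A := (hA j).2 ⟨hj, B₀, Reachable.refl _, h2⟩
  by_contra hmA
  -- The missing position `m` lies in a gap of `A`, which is either the inner arc between `lo` and
  -- `hi` or, when `m` precedes or follows all of `A`, the outer one. The nonconsecutive attachments
  -- `i, j` of `B₀` keep the other arc nonempty.
  have gap : ∃ lo ∈ A, ∃ hi ∈ A, (∃ s, Inner lo hi s) ∧ (∃ t < C.length, Outer lo hi t) ∧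
      ((∀ s ∈ A, ¬ Inner lo hi s) ∨ (∀ t ∈ A, ¬ Outer lo hi t)) := by
    unfold Inner Outer
    by_cases hbet : (∃ a ∈ A, a < m) ∧ (∃ b ∈ A, m < b)
    · obtain ⟨⟨a, ha, ham⟩, b, hb, hmb⟩ := hbet
      obtain ⟨lo, hlo, hlo'⟩ := (A.filter (· < m)).exists_maximal ⟨a, by simp [ha, ham]⟩
      obtain ⟨hi, hhi, hhi'⟩ := (A.filter (m < ·)).exists_minimal ⟨b, by simp [hb, hmb]⟩
      simp only [Finset.mem_filter] at hlo hlo' hhi hhi'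
      have gap : ∀ s ∈ A, ¬ (lo < s ∧ s < hi) := by
        intro s hs hs'
        have hne : s ≠ m := fun h => hmA (h ▸ hs)
        rcases hne.lt_or_gt with h | h
        · have := hlo' ⟨hs, h⟩ hs'.1.le
          omega
        · have := hhi' ⟨hs, h⟩ hs'.2.le
          omega
      refine ⟨lo, hlo.1, hi, hhi.1, ⟨m, hlo.2, hhi.2⟩, ?_, Or.inl gap⟩
      have g1 := gap i hiA
      have g2 := gap j hjA
      by_cases hi0 : i < lo ∨ hi < i
      · exact ⟨i, by omega, hi0⟩
      · by_cases hj0 : j < lo ∨ hi < j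
        · exact ⟨j, hj, hj0⟩
        · by_cases h0 : lo = 0
          · exact ⟨hi + 1, by omega, by omega⟩
          · exact ⟨0, by omega, by omega⟩
    · obtain ⟨lo, hlo, hlo'⟩ := A.exists_minimal ⟨i, hiA⟩
      obtain ⟨hi, hhi, hhi'⟩ := A.exists_maximal ⟨i, hiA⟩
      have hlo' : ∀ s ∈ A, lo ≤ s := fun s hs => (le_total lo s).elim id (hlo' hs)
      have hhi' : ∀ s ∈ A, s ≤ hi := fun s hs => (le_total s hi).elim id (hhi' hs)
      have e1 := hlo' i hiA
      have e2 := hhi' j hjA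
      refine ⟨lo, hlo, hi, hhi, ⟨i + 1, by omega, by omega⟩, ⟨m, hm, ?_⟩, Or.inr fun t ht h => ?_⟩
      · have h1 : lo ≠ m := fun h => hmA (h ▸ hlo)
        have h2 : hi ≠ m := fun h => hmA (h ▸ hhi)
        by_contra hcon
        exact hbet ⟨⟨lo, hlo, by omega⟩, hi, hhi, by omega⟩
      · have := hlo' t ht
        have := hhi' t ht
        omega
  obtain ⟨lo, hlo, hi, hhi, ⟨s, hs⟩, ⟨t, htl, ht⟩, hgap⟩ := gap
  obtain ⟨hlol, B, hB, hBlo⟩ := (hA lo).1 hlo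
  obtain ⟨hhil, B', hB', hBhi⟩ := (hA hi).1 hhi
  obtain ⟨D, hD, p, q, hp, hq, hpi, hqo, hpD, hqD⟩ := exists_bridge_across hG hC hhil hs htl ht
  have hnr : ¬ C.conflictGraph.Reachable B₀ ⟨D, hD⟩ := fun h => by
    rcases hgap with hgap | hgap
    · exact hgap p ((hA p).2 ⟨hp, _, h, hpD⟩) hpi
    · exact hgap q ((hA q).2 ⟨hq, _, h, hqD⟩) hqo
  unfold Inner Outer at *
  -- The cyclic order is `q, lo, p, hi` or `lo, p, hi, q`. Either way, the attachments `p, q` of `D`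
  -- separate `lo` from `hi`, which are both attached to bridges reachable from `B₀`.
  rcases hqo with hqo | hqo
  · exact not_inner_and_outer_of_reachable hC (p := q) (q := p) hp (D := ⟨D, hD⟩) hqD hpD
      (fun h => hnr (hB.trans h)) (hB.symm.trans hB') ⟨hqo, hpi.1⟩ (Or.inr hpi.2) hhil hBlo hBhi
  · exact not_inner_and_outer_of_reachable hC (p := p) (q := q) hq (D := ⟨D, hD⟩) hpD hqD
      (fun h => hnr (hB'.trans h)) (hB'.symm.trans hB) ⟨hpi.2, hqo⟩ (Or.inl hpi.1) hlol hBhi hBlo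

/-- The conflict graph of a cycle in a 3-connected graph is connected. -/
theorem connected_conflictGraph (hG : G.IsThreeConnected) (hC : C.IsCycle) :
    C.conflictGraph.Connected := by
  obtain ⟨B₁, hB₁⟩ := exists_isCycleBridge hG hC
  have : Nonempty {B : G.Subgraph // C.IsCycleBridge B} := ⟨⟨B₁, hB₁⟩⟩
  refine ⟨fun B₀ D => ?_⟩
  by_contra hnr
  rcases D.2.exists_attachments hG hC with ⟨p, q, hpq, hq, hpq0, h1, h2⟩ | ⟨hn, hD⟩
  -- Position `p + 1` lies strictly between `p` and `q`, and some `t` lies strictly outside. Both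
  -- are attached to bridges reachable from `B₀`, on different sides of `D`.
  · obtain ⟨B, hB, hBp⟩ := exists_reachable_attached hG hC B₀ (m := p + 1) (by omega)
    obtain ⟨t, htl, ht⟩ : ∃ t < C.length, Outer p q t := by
      by_cases h0 : p = 0
      · exact ⟨q + 1, by omega, Or.inr (by omega)⟩
      · exact ⟨0, by omega, Or.inl (by omega)⟩
    obtain ⟨B', hB', hBt⟩ := exists_reachable_attached hG hC B₀ htl
    exact not_inner_and_outer_of_reachable hC hq h1 h2 (fun h => hnr (hB.trans h))
      (hB.symm.trans hB') ⟨by omega, by omega⟩ ht htl hBp hBt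
  · rcases B₀.2.exists_attachments hG hC with ⟨i, j, hij, hj, hij0, -⟩ | ⟨-, hB⟩
    -- Two nonconsecutive positions force length at least 4, against `hn`.
    · omega
    · have hne : B₀ ≠ D := fun h => hnr (h ▸ Reachable.refl _)
      have hv : ∀ i < 3, ∀ j < 3, i ≠ j → C.getVert i ≠ C.getVert j :=
        fun i hi j hj h e => h (hC.getVert_inj (by omega) (by omega) e)
      have hm : ∀ i < 3, C.getVert i ∈ C.attachments B₀.1 ∩ C.attachments D.1 :=
        fun i hi => ⟨hB i (by omega), hD i (by omega)⟩
      refine hnr (Adj.reachable (show C.conflictGraph.Adj B₀ D from ⟨hne, Or.inr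
        ⟨C.getVert 0, C.getVert 1, C.getVert 2, ?_, ?_, ?_, ?_, ?_, ?_⟩⟩)) <;>
      first | exact hv _ (by norm_num) _ (by norm_num) (by norm_num) | exact hm _ (by norm_num)

end Walk

end SimpleGraph

theorem mainTheorem6 {V : Type*} [Finite V] (G : SimpleGraph V)
    (hconn : G.IsThreeConnected) (hplanar : G.IsPlanar)
    {v₀ : V} (C : G.Walk v₀ v₀) (hC : C.IsCycle) :
    C.conflictGraph.IsBipartite ∧ C.conflictGraph.Connected :=
  ⟨SimpleGraph.Walk.isBipartite_conflictGraph hplanar hC,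
    SimpleGraph.Walk.connected_conflictGraph hconn hC⟩
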